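/- **Definitions.** Let $d\ge 2$. A *tiling* $T$ of $\mathbb R^d$ is a cover of $\mathbb R^d$ by labelled compact $d$-dimensional polyhedral sets (*tiles*) with pairwise disjoint interiors, each of which is, with its label, a translate of one of finitely many prototiles. Isometries act on tiles and tilings and preserve labels. A *patch* of $T$ is a finite set of its tiles; the *$r$-patch* at $x$, written $T[x,r]$, consists of the tiles that meet the closed ball of radius $r$ about $x$. *S-MLD equivalence.* $T_2$ is *S-locally derivable* from $T_1$ if there is $r>0$ such that, for every rigid motion (orientation preserving isometry) $\Phi$ of $\mathbb R^d$ and every $x$, $\Phi(T_1[x,r])=T_1[\Phi x,r]$ implies $\Phi(T_2[x,1])=T_2[\Phi x,1]$. $T_1$ and $T_2$ are *S-MLD* if each is S-locally derivable from the other. If $\Phi$ ranges over all isometries, orientation reversing ones included, we say that $T_1,T_2$ are *S-MLD with respect to all isometries*. *Point group.* $g\in O(d)$ *acts on* $T$ if for every patch $P$ of $T$ the rotate $g(P)$ is, up to translation, a patch of $T$. $T$ *has point group* $G$ if $G\le SO(d)$ is a finite group all of whose elements act on $T$ and there is $r>0$ such that $g\in G$ whenever $g\in SO(d)$ and, for some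 $r$-patch $P$ of $T$, $g(P)$ is up to translation a patch of $T$. Let $G_\pm\le O(d)$ be the extension of $G$ by the orientation reversing elements that act on $T$ (i.e. the largest subgroup of $O(d)$ that acts on $T$). *Spaces.* The translational hull $\Omega_t$ of $T$ is the set of tilings all of whose patches occur in $T$ up to translation; two of them are close if they agree on a large ball about the origin after a small translation followed by a small rotation. Let $K_n$ be the quotient of $\Omega_t$ that identifies tilings with the same $n$-patch at the origin. $G$ and $G_\pm$ act on $\Omega_t$ and on $K_n$. Let $E$ be a contractible space with a free action of $O(d)$ by homeomorphisms, and $e\in E$. For $Q=G$ or $Q=G_\pm$ the Borel space is $\Omega_Q=(\Omega_t\times E)/Q$, with approximants $(K_n\times E)/Q$; all are pointed by $(T,e)$. *Topological space groups.* $\Gamma_+^{\mathrm{pro}}$ (for $Q=G$) and $\Gamma^{\mathrm{pro}}$ (for $Q=G_\pm$) are the pro-fundamental groups of $\Omega_Q$, i.e. the towers $(\pi_1((K_n\times E)/Q))_{n\in\mathbb N}$ with the maps induced by the forgetful maps $K_n\to K_m$ ($m \le n$); $\Gamma_+$ and $\Gamma$ are their inverse limits. **Theorem (S-MLD invariance of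 topological space groups).** Let $T_1,T_2$ be tilings of $\mathbb R^d$ that have point groups. 1. If $T_1$ and $T_2$ are S-MLD, then $\Gamma_+^{\mathrm{pro}}(T_1)$ and $\Gamma_+^{\mathrm{pro}}(T_2)$ are pro-equivalent (isomorphic in the category of pro-groups), and $\Gamma_+(T_1)\cong\Gamma_+(T_2)$. 2. If $T_1$ and $T_2$ are S-MLD with respect to all isometries, then $\Gamma^{\mathrm{pro}}(T_1)$ and $\Gamma^{\mathrm{pro}}(T_2)$ are pro-equivalent, and $\Gamma(T_1)\cong\Gamma(T_2)$. In both cases the same holds for the towers of fundamental groups, and their inverse limits, of any expansions of the pointed spaces $\Omega_Q(T_1)$ and $\Omega_Q(T_2)$ by inverse sequences $X_0\leftarrow X_1\leftarrow\cdots$ of pointed CW complexes. Here an *expansion* of a pointed space $X$ is such a sequence with compatible (up to pointed homotopy) pointed maps $X\to X_n$ such that, up to pointed homotopy, every map from $X$ to a pointed CW complex factors through some $X_n$, and any two maps out of $X_n$ to the same CW complex that agree on $X$ already agree on some $X_k$, $k\ge n$. -/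

import Mathlib

open scoped Pointwise

namespace TilingSpace

noncomputable section

/-! ### Euclidean space and its isometries -/

/-- Euclidean space of dimension `d`. -/
abbrev Euc (d : ℕ) : Type := EuclideanSpace ℝ (Fin d)

/-- The orthogonal group `O(d)`. -/
abbrev Orth (d : ℕ) : Type := Euc d ≃ₗᵢ[ℝ] Euc d

/-- The group of all isometries of Euclidean space. -/
abbrev Isom (d : ℕ) : Type := Euc d ≃ᵃⁱ[ℝ] Euc d

/-- The special orthogonal group `SO(d)`, as a subgroup of `O(d)`. -/
def SO (d : ℕ) : Subgroup (Orth d) where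
  carrier := {g | LinearMap.det (g.toLinearEquiv : Euc d →ₗ[ℝ] Euc d) = 1}
  one_mem' := LinearMap.det_id
  mul_mem' := by
    intro a b ha hb
    have h : ((a * b).toLinearEquiv : Euc d →ₗ[ℝ] Euc d)
        = (a.toLinearEquiv : Euc d →ₗ[ℝ] Euc d) ∘ₗ (b.toLinearEquiv : Euc d →ₗ[ℝ] Euc d) := rfl
    simp only [Set.mem_ofPred_eq] at *
    rw [h, LinearMap.det_comp, ha, hb, one_mul]
  inv_mem' := by
    intro a ha
    have h : (a.toLinearEquiv : Euc d →ₗ[ℝ] Euc d)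
        ∘ₗ ((a⁻¹).toLinearEquiv : Euc d →ₗ[ℝ] Euc d) = LinearMap.id := by
      ext1 x
      exact a.apply_symm_apply x
    simp only [Set.mem_ofPred_eq] at *
    have h2 := congrArg LinearMap.det h
    rwa [LinearMap.det_comp, ha, one_mul, LinearMap.det_id] at h2

/-- A linear isometry, as an isometry fixing the origin. -/
def rot {d : ℕ} (g : Orth d) : Isom d := g.toAffineIsometryEquiv

/-- The translation by `v`. -/
def trans {d : ℕ} (v : Euc d) : Isom d := AffineIsometryEquiv.constVAdd ℝ (Euc d) v

theorem rot_apply {d : ℕ} (g : Orth d) (x : Euc d) : rot g x = g x := rfl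

theorem trans_apply {d : ℕ} (v x : Euc d) : trans v x = v + x := rfl

theorem rot_one {d : ℕ} : rot (1 : Orth d) = 1 := by ext1 x; rfl

theorem rot_mul {d : ℕ} (g h : Orth d) : rot (g * h) = rot g * rot h := by ext1 x; rfl

theorem isom_mul_trans {d : ℕ} (Φ : Isom d) (v : Euc d) :
    Φ * trans v = trans (Φ.linearIsometryEquiv v) * Φ := by
  ext1 x
  exact Φ.map_vadd x v

theorem trans_zero {d : ℕ} : trans (0 : Euc d) = 1 := by
  ext1 x; exact zero_add x

theorem trans_add {d : ℕ} (v w : Euc d) : trans (v + w) = trans v * trans w := by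
  ext1 x; exact add_assoc v w x

/-! ### Tilings -/

/-- A labelled subset of Euclidean space. -/
@[ext] structure Tile (d : ℕ) (L : Type) where
  support : Set (Euc d)
  label : L

/-- Isometries move labelled subsets and preserve the labels. -/
instance {d : ℕ} {L : Type} : MulAction (Isom d) (Tile d L) where
  smul Φ t := ⟨Φ '' t.support, t.label⟩
  one_smul t := Tile.ext (Set.image_id t.support) rfl
  mul_smul Φ Ψ t := Tile.ext (Set.image_comp Φ Ψ t.support) rfl

theorem support_smul {d : ℕ} {L : Type} (Φ : Isom d) (t : Tile d L) :
    (Φ • t).support = Φ '' t.support := rfl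

/-- A compact `d`-dimensional polyhedral subset: a nonempty finite union of convex hulls of finite
sets, each with nonempty interior. -/
def IsPolyhedral {d : ℕ} (s : Set (Euc d)) : Prop :=
  ∃ F : Set (Set (Euc d)), F.Finite ∧ F.Nonempty ∧
    (∀ V ∈ F, V.Finite ∧ (interior (convexHull ℝ V)).Nonempty) ∧ s = ⋃ V ∈ F, convexHull ℝ V

theorem IsPolyhedral.image {d : ℕ} {s : Set (Euc d)} (hs : IsPolyhedral s) (Φ : Isom d) :
    IsPolyhedral (Φ '' s) := by
  have hconv (V : Set (Euc d)) : Φ '' convexHull ℝ V = convexHull ℝ (Φ '' V) :=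
    Φ.toAffineEquiv.toAffineMap.image_convexHull V
  obtain ⟨F, hF, hne, hV, rfl⟩ := hs
  refine ⟨(fun V => Φ '' V) '' F, hF.image _, hne.image _, ?_, ?_⟩
  · rintro _ ⟨V, hVF, rfl⟩
    refine ⟨(hV V hVF).1.image _, ?_⟩
    rw [← hconv]
    have h := Φ.toHomeomorph.image_interior (convexHull ℝ V)
    have h' : Φ '' interior (convexHull ℝ V) = interior (Φ '' convexHull ℝ V) := h
    rw [← h']
    exact (hV V hVF).2.image _
  · rw [Set.image_iUnion₂, Set.biUnion_image]
    exact Set.iUnion₂_congr fun V _ => hconv V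

/-- A tiling: a cover by compact polyhedral tiles which have pairwise disjoint interiors and which
are, with their labels, translates of finitely many prototiles. -/
@[ext] structure Tiling (d : ℕ) (L : Type) where
  tiles : Set (Tile d L)
  polyhedral : ∀ t ∈ tiles, IsPolyhedral t.support
  covers : ⋃ t ∈ tiles, t.support = Set.univ
  disjoint : ∀ s ∈ tiles, ∀ t ∈ tiles, s ≠ t → Disjoint (interior s.support) (interior t.support)
  prototiles : ∃ F : Set (Tile d L), F.Finite ∧ ∀ t ∈ tiles, ∃ p ∈ F, ∃ v : Euc d, t = trans v • p

/-- The image of a tiling under an isometry. -/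
def Tiling.move {d : ℕ} {L : Type} (Φ : Isom d) (T : Tiling d L) : Tiling d L where
  tiles := Φ • T.tiles
  polyhedral := by
    rintro _ ⟨t, ht, rfl⟩
    exact (T.polyhedral t ht).image Φ
  covers := by
    refine Set.eq_univ_of_forall fun x => ?_
    have hx : Φ.symm x ∈ ⋃ t ∈ T.tiles, t.support := T.covers ▸ Set.mem_univ _
    obtain ⟨t, ht, hxt⟩ := Set.mem_iUnion₂.1 hx
    exact Set.mem_iUnion₂.2 ⟨Φ • t, Set.smul_mem_smul_set ht, Φ.symm x, hxt, Φ.apply_symm_apply x⟩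
  disjoint := by
    rintro _ ⟨s, hs, rfl⟩ _ ⟨t, ht, rfl⟩ hst
    have h (u : Set (Euc d)) : interior (Φ '' u) = Φ '' interior u :=
      (Φ.toHomeomorph.image_interior u).symm
    change Disjoint (interior (Φ '' s.support)) (interior (Φ '' t.support))
    rw [h, h, Set.disjoint_image_iff Φ.injective]
    exact T.disjoint s hs t ht fun e => hst (by rw [e])
  prototiles := by
    obtain ⟨F, hfin, h⟩ := T.prototiles
    refine ⟨(fun p => Φ • p) '' F, hfin.image _, ?_⟩
    rintro _ ⟨t, ht, rfl⟩
    obtain ⟨p, hp, v, rfl⟩ := h t ht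
    refine ⟨Φ • p, ⟨p, hp, rfl⟩, Φ.linearIsometryEquiv v, ?_⟩
    change Φ • trans v • p = _
    rw [smul_smul, smul_smul, isom_mul_trans]

/-- Isometries act on tilings. -/
instance {d : ℕ} {L : Type} : MulAction (Isom d) (Tiling d L) where
  smul := Tiling.move
  one_smul T := Tiling.ext (one_smul _ T.tiles)
  mul_smul Φ Ψ T := Tiling.ext (mul_smul Φ Ψ T.tiles)

theorem tiles_smul {d : ℕ} {L : Type} (Φ : Isom d) (T : Tiling d L) :
    (Φ • T).tiles = Φ • T.tiles := rfl

/-- The `r`-patch of a set of tiles centred at `x`: the tiles which intersect the closed ball of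
radius `r` about `x`. -/
def rPatch {d : ℕ} {L : Type} (P : Set (Tile d L)) (r : ℝ) (x : Euc d) : Set (Tile d L) :=
  {t ∈ P | (t.support ∩ Metric.closedBall x r).Nonempty}

theorem rPatch_smul {d : ℕ} {L : Type} (Φ : Isom d) (P : Set (Tile d L)) (r : ℝ) (x : Euc d) :
    rPatch (Φ • P) r (Φ x) = Φ • rPatch P r x := by
  ext t
  constructor
  · rintro ⟨⟨s, hs, rfl⟩, _, ⟨y, hy, rfl⟩, hyr⟩
    exact ⟨s, ⟨hs, y, hy, by simpa [Metric.mem_closedBall, Φ.dist_map] using hyr⟩, rfl⟩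
  · rintro ⟨s, ⟨hs, y, hy, hyr⟩, rfl⟩
    exact ⟨⟨s, hs, rfl⟩, Φ y, ⟨y, hy, rfl⟩,
      by simpa [Metric.mem_closedBall, Φ.dist_map] using hyr⟩

theorem rPatch_eq_of_le {d : ℕ} {L : Type} {P Q : Set (Tile d L)} {r s : ℝ} {x : Euc d}
    (hrs : r ≤ s) (h : rPatch P s x = rPatch Q s x) : rPatch P r x = rPatch Q r x := by
  have key (P Q : Set (Tile d L)) (h : rPatch P s x = rPatch Q s x) :
      rPatch P r x ⊆ rPatch Q r x := by
    rintro t ⟨ht, hn⟩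
    have h1 : t ∈ rPatch P s x :=
      ⟨ht, hn.mono (Set.inter_subset_inter_right _ (Metric.closedBall_subset_closedBall hrs))⟩
    rw [h] at h1
    exact ⟨h1.1, hn⟩
  exact (key P Q h).antisymm (key Q P h.symm)

theorem IsPolyhedral.isBounded {d : ℕ} {s : Set (Euc d)} (hs : IsPolyhedral s) :
    Bornology.IsBounded s := by
  obtain ⟨F, hF, -, hV, rfl⟩ := hs
  exact (Bornology.isBounded_biUnion hF).2 fun V hVF =>
    isBounded_convexHull.2 (hV V hVF).1.isBounded

theorem IsPolyhedral.interior_nonempty {d : ℕ} {s : Set (Euc d)} (hs : IsPolyhedral s) :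
    (interior s).Nonempty := by
  obtain ⟨F, -, ⟨V, hVF⟩, hV, rfl⟩ := hs
  exact (hV V hVF).2.mono (interior_mono (Set.subset_biUnion_of_mem hVF))

/-- The `r`-patches of a tiling are finite. -/
theorem Tiling.rPatch_finite {d : ℕ} {L : Type} (T : Tiling d L) (r : ℝ) (x : Euc d) :
    (rPatch T.tiles r x).Finite := by
  obtain ⟨F, hF, hp⟩ := T.prototiles
  have key (p : Tile d L) : {t ∈ rPatch T.tiles r x | ∃ v : Euc d, t = trans v • p}.Finite := by
    rcases Set.eq_empty_or_nonempty {t ∈ rPatch T.tiles r x | ∃ v : Euc d, t = trans v • p}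
      with h0 | ⟨t₀, ht₀, v₀, hv₀⟩
    · rw [h0]; exact Set.finite_empty
    have hpt : IsPolyhedral p.support := by
      have h := (T.polyhedral t₀ ht₀.1).image (trans v₀)⁻¹
      rw [hv₀, ← support_smul, smul_smul, inv_mul_cancel, one_smul] at h
      exact h
    obtain ⟨C, hC⟩ := Metric.isBounded_iff.1 hpt.isBounded
    set A := {t ∈ rPatch T.tiles r x | ∃ v : Euc d, t = trans v • p} with hA
    have hvol (t : A) :
        MeasureTheory.volume (interior t.1.support) = MeasureTheory.volume (interior p.support) := by
      obtain ⟨t, ht, v, rfl⟩ := t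
      have h : interior ((trans v • p).support) = (fun y => v + y) '' interior p.support :=
        ((trans v).toHomeomorph.image_interior p.support).symm
      change MeasureTheory.volume (interior ((trans v • p).support)) = _
      rw [h, Set.image_add_left, MeasureTheory.measure_preimage_add]
    have hfin := MeasureTheory.Measure.finite_const_le_meas_of_disjoint_iUnion
      (MeasureTheory.volume : MeasureTheory.Measure (Euc d))
      (isOpen_interior.measure_pos MeasureTheory.volume hpt.interior_nonempty)
      (As := fun t : A => interior t.1.support) (fun _ => isOpen_interior.measurableSet)
      (fun s t hst => T.disjoint _ s.2.1.1 _ t.2.1.1 fun e => hst (Subtype.ext e)) (by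
        refine (lt_of_le_of_lt (MeasureTheory.measure_mono ?_)
          (MeasureTheory.measure_closedBall_lt_top (x := x) (r := C + r))).ne
        refine Set.iUnion_subset ?_
        rintro ⟨t, ⟨ht, y, hy, hyr⟩, v, rfl⟩ z hz
        obtain ⟨y', hy', rfl⟩ := hy
        obtain ⟨z', hz', rfl⟩ := interior_subset hz
        have h1 := hC hz' hy'
        rw [← (trans v).dist_map] at h1
        exact (dist_triangle _ _ _).trans (add_le_add h1 hyr))
    have huniv : {t : A | MeasureTheory.volume (interior p.support)
        ≤ MeasureTheory.volume (interior t.1.support)} = Set.univ :=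
      Set.eq_univ_of_forall fun t => (hvol t).ge
    rw [huniv] at hfin
    exact Set.finite_coe_iff.1 (Set.finite_univ_iff.1 hfin)
  refine (hF.biUnion fun p _ => key p).subset fun t ht => ?_
  obtain ⟨p, hpF, v, hv⟩ := hp t ht.1
  exact Set.mem_biUnion hpF ⟨ht, v, hv⟩

/-- The set of tiles `P` occurs in `T` up to translation. -/
def Occurs {d : ℕ} {L : Type} (P : Set (Tile d L)) (T : Tiling d L) : Prop :=
  ∃ v : Euc d, trans v • P ⊆ T.tiles

/-! ### S-MLD equivalence

`H` is a group of linear isometries; only isometries with linear part in `H` are used. -/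

/-- `T₂` is S-locally derivable from `T₁`, with respect to the isometries with linear part in
`H`. -/
def SLocallyDerivable {d : ℕ} {L₁ L₂ : Type} (H : Subgroup (Orth d))
    (T₁ : Tiling d L₁) (T₂ : Tiling d L₂) : Prop :=
  ∃ r : ℝ, 0 < r ∧ ∀ (Φ : Isom d) (x : Euc d), Φ.linearIsometryEquiv ∈ H →
    Φ • rPatch T₁.tiles r x = rPatch T₁.tiles r (Φ x) →
    Φ • rPatch T₂.tiles 1 x = rPatch T₂.tiles 1 (Φ x)

/-- S-MLD equivalence with respect to the isometries with linear part in `H`. -/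
def IsSMLDFor {d : ℕ} {L₁ L₂ : Type} (H : Subgroup (Orth d))
    (T₁ : Tiling d L₁) (T₂ : Tiling d L₂) : Prop :=
  SLocallyDerivable H T₁ T₂ ∧ SLocallyDerivable H T₂ T₁

/-- S-MLD equivalence, by rigid motions (orientation preserving isometries). -/
def IsSMLD {d : ℕ} {L₁ L₂ : Type} (T₁ : Tiling d L₁) (T₂ : Tiling d L₂) : Prop :=
  IsSMLDFor (SO d) T₁ T₂

/-- S-MLD equivalence that incorporates the orientation reversing isometries. -/
def IsSMLDpm {d : ℕ} {L₁ L₂ : Type} (T₁ : Tiling d L₁) (T₂ : Tiling d L₂) : Prop :=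
  IsSMLDFor (⊤ : Subgroup (Orth d)) T₁ T₂

/-! ### Point groups -/

/-- `g` acts on `T`: for every patch `P` of `T`, also `g(P)` is a patch of `T`, up to
translation. -/
def Acts {d : ℕ} {L : Type} (g : Orth d) (T : Tiling d L) : Prop :=
  ∀ P ⊆ T.tiles, P.Finite → Occurs (rot g • P) T

theorem Acts.mul {d : ℕ} {L : Type} {g h : Orth d} {T : Tiling d L} (hg : Acts g T)
    (hh : Acts h T) : Acts (g * h) T := by
  intro P hP hfin
  obtain ⟨v, hv⟩ := hh P hP hfin
  obtain ⟨w, hw⟩ := hg _ hv ((hfin.smul_set).smul_set)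
  refine ⟨w + (rot g).linearIsometryEquiv v, ?_⟩
  rwa [rot_mul, trans_add, smul_smul, mul_assoc, ← mul_assoc (trans _) (rot g) (rot h),
    ← isom_mul_trans, mul_assoc, ← smul_smul, ← smul_smul, ← smul_smul]

theorem Acts.one {d : ℕ} {L : Type} (T : Tiling d L) : Acts (1 : Orth d) T := by
  intro P hP _
  exact ⟨0, by rwa [trans_zero, rot_one, one_smul, one_smul]⟩

/-- `T` has point group `G`: the finite group `G` of rotations acts on `T`, and there is `r > 0`
such that every rotation that takes some `r`-patch of `T` to a patch of `T`, up to translation,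
belongs to `G`. -/
structure IsPointGroup {d : ℕ} {L : Type} (T : Tiling d L) (G : Subgroup (Orth d)) : Prop where
  le : G ≤ SO d
  finite : Finite G
  acts : ∀ g ∈ G, Acts g T
  mem : ∃ r : ℝ, 0 < r ∧ ∀ g ∈ SO d, ∀ x : Euc d, Occurs (rot g • rPatch T.tiles r x) T → g ∈ G

/-- `T` has a point group. -/
def HasPointGroup {d : ℕ} {L : Type} (T : Tiling d L) : Prop :=
  ∃ G : Subgroup (Orth d), IsPointGroup T G

/-- The largest subgroup of `H` that acts on `T`. -/
def actingGroup {d : ℕ} {L : Type} (H : Subgroup (Orth d)) (T : Tiling d L) :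
    Subgroup (Orth d) where
  carrier := {g | g ∈ H ∧ Acts g T ∧ Acts g⁻¹ T}
  one_mem' := ⟨H.one_mem, Acts.one T, by rw [inv_one]; exact Acts.one T⟩
  mul_mem' := fun ha hb => ⟨H.mul_mem ha.1 hb.1, ha.2.1.mul hb.2.1,
    by rw [mul_inv_rev]; exact hb.2.2.mul ha.2.2⟩
  inv_mem' := fun ha => ⟨H.inv_mem ha.1, ha.2.2, by rw [inv_inv]; exact ha.2.1⟩

/-- The point group `G` of a tiling that has one. -/
abbrev pointGroup {d : ℕ} {L : Type} (T : Tiling d L) : Subgroup (Orth d) := actingGroup (SO d) T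

/-- If `T` has point group `G`, then `G` is the group `pointGroup T`. -/
theorem IsPointGroup.eq_pointGroup {d : ℕ} {L : Type} {T : Tiling d L} {G : Subgroup (Orth d)}
    (h : IsPointGroup T G) : pointGroup T = G := by
  obtain ⟨r, _, hmem⟩ := h.mem
  exact le_antisymm
    (fun g hg => hmem g hg.1 0 (hg.2.1 _ (fun t ht => ht.1) (T.rPatch_finite r 0)))
    fun g hg => ⟨h.le hg, h.acts g hg, h.acts _ (G.inv_mem hg)⟩

/-- The extension `G_±` of the point group by the reflections that act on `T`. -/
abbrev pointGroupPM {d : ℕ} {L : Type} (T : Tiling d L) : Subgroup (Orth d) := actingGroup ⊤ T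

/-! ### The translational hull -/

/-- `A` is locally indistinguishable from `T`: every patch of `A` occurs in `T` up to
translation. -/
def LocallyIndistinguishable {d : ℕ} {L : Type} (A T : Tiling d L) : Prop :=
  ∀ P ⊆ A.tiles, P.Finite → Occurs P T

theorem LocallyIndistinguishable.refl {d : ℕ} {L : Type} (T : Tiling d L) :
    LocallyIndistinguishable T T :=
  fun P hP _ => ⟨0, by rwa [trans_zero, one_smul]⟩

/-- The translational hull `Ω_t` of `T`. -/
def Hull {d : ℕ} {L : Type} (T : Tiling d L) : Type :=
  {A : Tiling d L // LocallyIndistinguishable A T}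

/-- `T` as a point of its hull. -/
def Hull.base {d : ℕ} {L : Type} (T : Tiling d L) : Hull T := ⟨T, .refl T⟩

/-- `A` agrees with `B` to radius `1 / ε` about the origin after moving `B` by a translation and
then a rotation, both of size at most `ε`. -/
def IsClose {d : ℕ} {L : Type} (ε : ℝ) (A B : Tiling d L) : Prop :=
  ∃ (v : Euc d) (g : Orth d), ‖v‖ ≤ ε ∧ g ∈ SO d ∧ (∀ x, ‖g x - x‖ ≤ ε * ‖x‖) ∧
    rPatch (rot g • trans v • B).tiles (1 / ε) 0 = rPatch A.tiles (1 / ε) 0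

theorem IsClose.mono {d : ℕ} {L : Type} {ε δ : ℝ} {A B : Tiling d L} (hε : 0 < ε) (h : ε ≤ δ) :
    IsClose ε A B → IsClose δ A B := by
  rintro ⟨v, g, hv, hg, hgx, hp⟩
  exact ⟨v, g, hv.trans h, hg,
    fun x => (hgx x).trans (mul_le_mul_of_nonneg_right h (norm_nonneg x)),
    rPatch_eq_of_le (one_div_le_one_div_of_le hε h) hp⟩

/-- The tiling topology: `A` has the neighbourhoods `{B | IsClose ε A B}`, `ε > 0`. -/
instance {d : ℕ} {L : Type} (T : Tiling d L) : TopologicalSpace (Hull T) where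
  IsOpen U := ∀ A ∈ U, ∃ ε : ℝ, 0 < ε ∧ ∀ B : Hull T, IsClose ε A.1 B.1 → B ∈ U
  isOpen_univ := fun _ _ => ⟨1, one_pos, fun _ _ => Set.mem_univ _⟩
  isOpen_inter := by
    rintro U V hU hV A ⟨hAU, hAV⟩
    obtain ⟨ε, hε, h⟩ := hU A hAU
    obtain ⟨δ, hδ, k⟩ := hV A hAV
    have hm : 0 < min ε δ := lt_min hε hδ
    exact ⟨min ε δ, hm, fun B hB =>
      ⟨h B (hB.mono hm (min_le_left _ _)), k B (hB.mono hm (min_le_right _ _))⟩⟩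
  isOpen_sUnion := by
    rintro S hS A ⟨U, hU, hA⟩
    obtain ⟨ε, hε, h⟩ := hS U hU A hA
    exact ⟨ε, hε, fun B hB => ⟨U, hU, h B hB⟩⟩

theorem LocallyIndistinguishable.rot {d : ℕ} {L : Type} {A T : Tiling d L} {g : Orth d}
    (hg : Acts g T) (hA : LocallyIndistinguishable A T) :
    LocallyIndistinguishable (rot g • A) T := by
  intro P hP hfin
  have hP' : (TilingSpace.rot g)⁻¹ • P ⊆ A.tiles := by
    rw [Set.smul_set_subset_iff_subset_inv_smul_set, inv_inv]; exact hP
  obtain ⟨v, hv⟩ := hA _ hP' hfin.smul_set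
  obtain ⟨w, hw⟩ := hg _ hv hfin.smul_set.smul_set
  refine ⟨w + (TilingSpace.rot g).linearIsometryEquiv v, ?_⟩
  rwa [smul_smul (TilingSpace.rot g), isom_mul_trans, smul_smul, smul_smul, ← mul_assoc,
    mul_assoc, mul_inv_cancel, mul_one, ← trans_add] at hw

/-- The acting group acts on the hull, by `g · A = g(A)`. -/
instance {d : ℕ} {L : Type} (H : Subgroup (Orth d)) (T : Tiling d L) :
    MulAction (actingGroup H T) (Hull T) where
  smul g A := ⟨rot g.1 • A.1, A.2.rot g.2.2.1⟩
  one_smul A := Subtype.ext (by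
    change rot (1 : Orth d) • A.1 = A.1
    rw [rot_one, one_smul])
  mul_smul g h A := Subtype.ext (by
    change rot (g.1 * h.1) • A.1 = rot g.1 • rot h.1 • A.1
    rw [rot_mul, mul_smul])

/-! ### Approximants -/

/-- Agreement of the patches of radius `n` about the origin. -/
def approxSetoid {d : ℕ} {L : Type} (T : Tiling d L) (n : ℕ) : Setoid (Hull T) :=
  Setoid.ker fun A => rPatch A.1.tiles n 0

/-- The approximant `K_n` of the translational hull. -/
def Approx {d : ℕ} {L : Type} (T : Tiling d L) (n : ℕ) : Type := Quotient (approxSetoid T n)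

instance {d : ℕ} {L : Type} (T : Tiling d L) (n : ℕ) : TopologicalSpace (Approx T n) :=
  inferInstanceAs (TopologicalSpace (Quotient (approxSetoid T n)))

theorem rPatch_rot_zero {d : ℕ} {L : Type} (g : Orth d) (A : Tiling d L) (r : ℝ) :
    rPatch (rot g • A).tiles r 0 = rot g • rPatch A.tiles r 0 := by
  have h := rPatch_smul (rot g) A.tiles r 0
  rwa [rot_apply, map_zero] at h

/-- The acting group acts on the approximants, by rotating patches about the origin. -/
instance {d : ℕ} {L : Type} (H : Subgroup (Orth d)) (T : Tiling d L) (n : ℕ) :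
    MulAction (actingGroup H T) (Approx T n) where
  smul g := Quotient.map (g • ·) fun A B (h : rPatch A.1.tiles n 0 = rPatch B.1.tiles n 0) => by
    change rPatch (rot g.1 • A.1).tiles n 0 = rPatch (rot g.1 • B.1).tiles n 0
    rw [rPatch_rot_zero, rPatch_rot_zero, h]
  one_smul := by
    rintro ⟨A⟩
    exact congrArg (Quotient.mk _) (one_smul _ A)
  mul_smul := by
    rintro g h ⟨A⟩
    exact congrArg (Quotient.mk _) (mul_smul g h A)

/-- The forgetful map `K_n → K_m` for `m ≤ n`. -/
def Approx.forget {d : ℕ} {L : Type} (T : Tiling d L) {m n : ℕ} (h : m ≤ n) :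
    Approx T n → Approx T m :=
  Quotient.map' id fun _ _ hAB => rPatch_eq_of_le (Nat.cast_le.2 h) hAB

theorem Approx.continuous_forget {d : ℕ} {L : Type} (T : Tiling d L) {m n : ℕ} (h : m ≤ n) :
    Continuous (Approx.forget T h) :=
  continuous_id.quotient_map' _

/-! ### The Borel construction -/

/-- The Borel construction `(X × E) / G` with the diagonal action, for a contractible free
`G`-space `E`. -/
abbrev Borel (G X E : Type) [Group G] [MulAction G X] [MulAction G E] : Type :=
  Quotient (MulAction.orbitRel G (X × E))

/-- The point `[x, e]` of the Borel construction. -/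
def Borel.mk (G : Type) {X E : Type} [Group G] [MulAction G X] [MulAction G E] (x : X) (e : E) :
    Borel G X E :=
  Quotient.mk _ (x, e)

/-- The Borel space `Ω_G`. -/
abbrev OmegaG {d : ℕ} {L : Type} (T : Tiling d L) (E : Type) [MulAction (Orth d) E] : Type :=
  Borel (pointGroup T) (Hull T) E

/-- The Borel space `Ω_{G_±}`. -/
abbrev OmegaGPM {d : ℕ} {L : Type} (T : Tiling d L) (E : Type) [MulAction (Orth d) E] : Type :=
  Borel (pointGroupPM T) (Hull T) E

/-- The base point of `Ω_G` given by `T` and a point of `E`. -/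
def OmegaG.base {d : ℕ} {L : Type} (T : Tiling d L) {E : Type} [MulAction (Orth d) E] (e : E) :
    OmegaG T E :=
  Borel.mk (pointGroup T) (Hull.base T) e

/-- The base point of `Ω_{G_±}` given by `T` and a point of `E`. -/
def OmegaGPM.base {d : ℕ} {L : Type} (T : Tiling d L) {E : Type} [MulAction (Orth d) E] (e : E) :
    OmegaGPM T E :=
  Borel.mk (pointGroupPM T) (Hull.base T) e

/-- The approximant `(K_n × E) / G` of the Borel space, for `G` the subgroup of `H` that acts on
`T`. -/
abbrev ApproxBorel {d : ℕ} {L : Type} (H : Subgroup (Orth d)) (T : Tiling d L) (E : Type)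
    [MulAction (Orth d) E] (n : ℕ) : Type :=
  Borel (actingGroup H T) (Approx T n) E

/-- The map of Borel approximants induced by the forgetful map and the identity of `E`. -/
def ApproxBorel.forget {d : ℕ} {L : Type} (H : Subgroup (Orth d)) (T : Tiling d L) (E : Type)
    [TopologicalSpace E] [MulAction (Orth d) E] {m n : ℕ} (h : m ≤ n) :
    C(ApproxBorel H T E n, ApproxBorel H T E m) where
  toFun := Quotient.map (Prod.map (Approx.forget T h) id) (by
    rintro _ ⟨k, e⟩ ⟨g, rfl⟩
    induction k using Quotient.inductionOn with
    | h A => exact ⟨g, rfl⟩)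
  continuous_toFun := ((Approx.continuous_forget T h).prodMap continuous_id).quotient_map' _

/-! ### Pro-groups -/

/-- A pro-group: an inverse system of groups indexed by the natural numbers. -/
structure ProGroup where
  obj : ℕ → Type
  [group : ∀ n, Group (obj n)]
  map : ∀ {m n : ℕ}, m ≤ n → (obj n →* obj m)
  map_refl : ∀ (n : ℕ) (x : obj n), map (le_refl n) x = x
  map_map : ∀ {l m n : ℕ} (h : l ≤ m) (h' : m ≤ n) (x : obj n),
    map h (map h' x) = map (h.trans h') x

attribute [instance] ProGroup.group

/-- A morphism of pro-groups: homomorphisms `P_{φ(n)} → Q_n` for a monotone index function `φ`,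
commuting with the structure maps. -/
structure ProGroup.Hom (P Q : ProGroup) where
  idx : ℕ → ℕ
  mono : Monotone idx
  app : ∀ n, P.obj (idx n) →* Q.obj n
  comm : ∀ {m n : ℕ} (h : m ≤ n) (x : P.obj (idx n)),
    Q.map h (app n x) = app m (P.map (mono h) x)

/-- Pro-equivalence: there are morphisms in both directions whose composites agree with the
structure maps (that is, represent the identities in the pro-category). -/
def ProGroup.Equiv (P Q : ProGroup) : Prop :=
  ∃ (f : P.Hom Q) (g : Q.Hom P),
    (∀ n, ∃ (k : ℕ) (h : n ≤ k) (h' : f.idx (g.idx n) ≤ k), ∀ x : P.obj k,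
      g.app n (f.app (g.idx n) (P.map h' x)) = P.map h x) ∧
    (∀ n, ∃ (k : ℕ) (h : n ≤ k) (h' : g.idx (f.idx n) ≤ k), ∀ x : Q.obj k,
      f.app n (g.app (f.idx n) (Q.map h' x)) = Q.map h x)

/-- The inverse limit of a pro-group. -/
def ProGroup.lim (P : ProGroup) : Subgroup (∀ n, P.obj n) where
  carrier := {x | ∀ {m n : ℕ} (h : m ≤ n), P.map h (x n) = x m}
  one_mem' := fun _ => map_one _
  mul_mem' := fun {a b} ha hb m n h => by
    change P.map h (a n * b n) = a m * b m
    rw [map_mul, ha h, hb h]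
  inv_mem' := fun {a} ha m n h => by
    change P.map h (a n)⁻¹ = (a m)⁻¹
    rw [map_inv, ha h]

/-! ### Towers of pointed spaces and expansions -/

/-- An inverse sequence of pointed spaces. -/
structure PointedTower where
  obj : ℕ → Type
  [top : ∀ n, TopologicalSpace (obj n)]
  pt : ∀ n, obj n
  map : ∀ {m n : ℕ}, m ≤ n → C(obj n, obj m)
  map_pt : ∀ {m n : ℕ} (h : m ≤ n), map h (pt n) = pt m
  map_refl : ∀ (n : ℕ) (x : obj n), map (le_refl n) x = x
  map_map : ∀ {l m n : ℕ} (h : l ≤ m) (h' : m ≤ n) (x : obj n),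
    map h (map h' x) = map (h.trans h') x

attribute [instance] PointedTower.top

/-- The pro-group of fundamental groups of an inverse sequence of pointed spaces. -/
def PointedTower.proPi1 (S : PointedTower) : ProGroup where
  obj n := FundamentalGroup (S.obj n) (S.pt n)
  map h := FundamentalGroup.mapOfEq (S.map h) (S.map_pt h)
  map_refl n x := by
    refine (FundamentalGroup.mapOfEq_apply _ _ x).trans ?_
    induction x using Path.Homotopic.Quotient.ind with
    | mk p =>
      refine congrArg Path.Homotopic.Quotient.mk ?_
      ext t
      exact S.map_refl n (p t)
  map_map h h' x := by
    refine (FundamentalGroup.mapOfEq_apply _ _ _).trans ?_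
    rw [FundamentalGroup.mapOfEq_apply]
    refine Eq.trans ?_ (FundamentalGroup.mapOfEq_apply _ _ x).symm
    induction x using Path.Homotopic.Quotient.ind with
    | mk p =>
      refine congrArg Path.Homotopic.Quotient.mk ?_
      ext t
      exact S.map_map h h' (p t)

/-- `X` is a CW complex. -/
def IsCW (X : Type) [TopologicalSpace X] : Prop :=
  T2Space X ∧ Nonempty (Topology.CWComplex (Set.univ : Set X))

/-- The inverse sequence `S` of pointed CW complexes, with the maps `p n : X → S.obj n`, is an
expansion of the pointed space `(X, x)`: up to pointed homotopy, every map from `X` to a CW complex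
factors through some `S.obj n`, and two factorisations become homotopic further along `S`. -/
structure IsExpansion {X : Type} [TopologicalSpace X] (x : X) (S : PointedTower)
    (p : ∀ n, C(X, S.obj n)) : Prop where
  cw : ∀ n, IsCW (S.obj n)
  pt : ∀ n, p n x = S.pt n
  comm : ∀ {m n : ℕ} (h : m ≤ n), ((S.map h).comp (p n)).HomotopicRel (p m) {x}
  factor : ∀ (Y : Type) [TopologicalSpace Y], IsCW Y → ∀ f : C(X, Y),
    ∃ (n : ℕ) (g : C(S.obj n, Y)), (g.comp (p n)).HomotopicRel f {x}
  unique : ∀ (Y : Type) [TopologicalSpace Y], IsCW Y → ∀ (n : ℕ) (g g' : C(S.obj n, Y)),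
    (g.comp (p n)).HomotopicRel (g'.comp (p n)) {x} →
    ∃ (k : ℕ) (h : n ≤ k), (g.comp (S.map h)).HomotopicRel (g'.comp (S.map h)) {S.pt k}

/-- `P` is a pro-fundamental group of the pointed space `(X, x)`: it is pro-equivalent to the tower
of fundamental groups of an expansion of `(X, x)`. -/
def IsProPi1 {X : Type} [TopologicalSpace X] (x : X) (P : ProGroup) : Prop :=
  ∃ (S : PointedTower) (p : ∀ n, C(X, S.obj n)), IsExpansion x S p ∧ P.Equiv S.proPi1

/-! ### Topological space groups -/

/-- The tower of approximants of the Borel space, pointed by `T` and a point of `E`. -/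
def borelTower {d : ℕ} {L : Type} (H : Subgroup (Orth d)) (T : Tiling d L) {E : Type}
    [TopologicalSpace E] [MulAction (Orth d) E] (e : E) : PointedTower where
  obj n := ApproxBorel H T E n
  pt n := Borel.mk (actingGroup H T) (Quotient.mk (approxSetoid T n) (Hull.base T)) e
  map h := ApproxBorel.forget H T E h
  map_pt _ := rfl
  map_refl := by
    rintro n ⟨⟨A⟩, e⟩
    rfl
  map_map := by
    rintro l m n h h' ⟨⟨A⟩, e⟩
    rfl

/-- The pro-fundamental group of the Borel space, presented by its tower of approximants. -/
def proSpaceGroup {d : ℕ} {L : Type} (H : Subgroup (Orth d)) (T : Tiling d L) {E : Type}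
    [TopologicalSpace E] [MulAction (Orth d) E] (e : E) : ProGroup :=
  (borelTower H T e).proPi1

/-- The positive topological space pro-group: the pro-fundamental group of `Ω_G`. -/
def GammaPlusPro {d : ℕ} {L : Type} (T : Tiling d L) {E : Type}
    [TopologicalSpace E] [MulAction (Orth d) E] (e : E) : ProGroup :=
  proSpaceGroup (SO d) T e

/-- The topological space pro-group: the pro-fundamental group of `Ω_{G_±}`. -/
def GammaPro {d : ℕ} {L : Type} (T : Tiling d L) {E : Type}
    [TopologicalSpace E] [MulAction (Orth d) E] (e : E) : ProGroup :=
  proSpaceGroup ⊤ T e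

/-- The positive topological space group. -/
abbrev GammaPlus {d : ℕ} {L : Type} (T : Tiling d L) {E : Type}
    [TopologicalSpace E] [MulAction (Orth d) E] (e : E) : Type :=
  (GammaPlusPro T e).lim

/-- The topological space group. -/
abbrev Gamma {d : ℕ} {L : Type} (T : Tiling d L) {E : Type}
    [TopologicalSpace E] [MulAction (Orth d) E] (e : E) : Type :=
  (GammaPro T e).lim

end

end TilingSpace

open TilingSpace

namespace TilingSpace

noncomputable section

/-! ### Linear parts of isometries -/

-- The derivation rule says that the tiles of `T₂` near a point depend only on the `r`-patch of `T₁`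
-- there, covariantly under isometries with linear part in `H`. A tiling `A` in the hull of `T₁`
-- looks, on each bounded region, like a translate of `T₁`, so the rule can be run on `A`: wherever
-- `A` looks like `Φ • T₁`, lay down the tiles of `Φ • T₂`. The result does not depend on the choice
-- of `Φ`, and the `(R + r)`-patch of `A` determines its `R`-patch
-- (`DerivesWith.rPatch_deriveTiles`). This gives a continuous base point preserving map of hulls,
-- and mutual derivations give inverse maps (`DerivesWith.hullMap_hullMap`). The same elements of
-- `H` act on both tilings, and the map is equivariant (`DerivesWith.hullMap_smul`).
--
-- There are two consequences. Since a derivation costs only `r` in radius, it induces maps from the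
-- approximant at level `n + ⌈r⌉₊` to the one at level `n`. Their composites in either order are
-- forgetful maps, so the Borel towers are interleaved and their fundamental groups are
-- pro-equivalent (`DerivesWith.proSpaceGroup_equiv`). Moreover, the Borel spaces themselves are
-- homeomorphic as pointed spaces, and an expansion of a pointed space is unique enough to determine
-- its tower of fundamental groups up to pro-equivalence (`IsExpansion.proPi1_equiv`). The
-- approximants therefore need not be compared with CW expansions. Inverse limits follow from
-- `ProGroup.Equiv.lim_mulEquiv`.

theorem linear_trans {d : ℕ} (w : Euc d) : (trans w).linearIsometryEquiv = 1 := by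
  ext1 x
  have h := (trans w).map_vadd 0 x
  simp only [vadd_eq_add, trans_apply, add_zero] at h
  rw [add_comm w x] at h
  exact (add_right_cancel h).symm

theorem linear_rot {d : ℕ} (g : Orth d) : (rot g).linearIsometryEquiv = g := by
  ext1 x; rfl

theorem linear_mul {d : ℕ} (Φ Ψ : Isom d) :
    (Φ * Ψ).linearIsometryEquiv = Φ.linearIsometryEquiv * Ψ.linearIsometryEquiv := by
  ext1 x; rfl

theorem linear_inv {d : ℕ} (Φ : Isom d) :
    (Φ⁻¹).linearIsometryEquiv = (Φ.linearIsometryEquiv)⁻¹ := by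
  ext1 x; rfl

theorem linear_trans_mem {d : ℕ} (H : Subgroup (Orth d)) (w : Euc d) :
    (trans w).linearIsometryEquiv ∈ H := linear_trans w ▸ H.one_mem

/-! ### Patches -/

theorem rPatch_subset {d : ℕ} {L : Type} (P : Set (Tile d L)) (r : ℝ) (x : Euc d) :
    rPatch P r x ⊆ P := fun _ h => h.1

theorem rPatch_eq_of_closedBall {d : ℕ} {L : Type} {P Q : Set (Tile d L)} {r s : ℝ} {x y : Euc d}
    (hb : s + dist y x ≤ r) (h : rPatch P r x = rPatch Q r x) :
    rPatch P s y = rPatch Q s y := by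
  have key (P Q : Set (Tile d L)) (h : rPatch P r x = rPatch Q r x) :
      rPatch P s y ⊆ rPatch Q s y := by
    rintro t ⟨ht, hn⟩
    have h1 : t ∈ rPatch P r x :=
      ⟨ht, hn.mono (Set.inter_subset_inter_right _ (Metric.closedBall_subset_closedBall' hb))⟩
    rw [h] at h1
    exact ⟨h1.1, hn⟩
  exact (key P Q h).antisymm (key Q P h.symm)

theorem rPatch_smul_eq {d : ℕ} {L : Type} {P Q : Set (Tile d L)} {r : ℝ} {x : Euc d}
    (Φ : Isom d) (h : rPatch P r x = rPatch Q r x) :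
    rPatch (Φ • P) r (Φ x) = rPatch (Φ • Q) r (Φ x) := by
  rw [rPatch_smul, rPatch_smul, h]

/-- Tiles are nonempty, so each one lies in some patch about the origin. Equality of points of a
hull can thus be checked patch by patch. -/
theorem tiles_eq_of_rPatch_eq {d : ℕ} {L : Type} {A B : Tiling d L}
    (h : ∀ R : ℝ, 0 ≤ R → rPatch A.tiles R 0 = rPatch B.tiles R 0) : A = B := by
  have key (A B : Tiling d L) (h : ∀ R : ℝ, 0 ≤ R → rPatch A.tiles R 0 = rPatch B.tiles R 0) :
      A.tiles ⊆ B.tiles := by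
    intro t ht
    obtain ⟨y, hy⟩ := (A.polyhedral t ht).interior_nonempty
    have h1 : t ∈ rPatch A.tiles (dist y 0) 0 :=
      ⟨ht, y, interior_subset hy, Metric.mem_closedBall.2 le_rfl⟩
    rw [h _ dist_nonneg] at h1
    exact h1.1
  exact Tiling.ext ((key A B h).antisymm (key B A fun R hR => (h R hR).symm))

theorem Tiling.exists_subset_rPatch {d : ℕ} {L : Type} (A : Tiling d L) {P : Set (Tile d L)}
    (hP : P ⊆ A.tiles) (hfin : P.Finite) : ∃ R : ℝ, 0 ≤ R ∧ P ⊆ rPatch A.tiles R 0 := by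
  have hne (t : P) : ∃ y, y ∈ t.1.support :=
    (A.polyhedral t.1 (hP t.2)).interior_nonempty.mono interior_subset
  choose y hy using hne
  have : Finite P := hfin
  obtain ⟨C, hC⟩ := (Set.finite_range fun t : P => dist (y t) 0).bddAbove
  refine ⟨max C 0, le_max_right _ _, fun t ht => ⟨hP ht, y ⟨t, ht⟩, hy ⟨t, ht⟩, ?_⟩⟩
  exact (hC ⟨⟨t, ht⟩, rfl⟩).trans (le_max_left _ _)

-- Polyhedral tiles as regular closed sets, and patches determined by inclusion

theorem IsPolyhedral.isClosed {d : ℕ} {s : Set (Euc d)} (hs : IsPolyhedral s) : IsClosed s := by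
  obtain ⟨F, hF, -, hV, rfl⟩ := hs
  exact hF.isClosed_biUnion fun V hVF => (hV V hVF).1.isClosed_convexHull ℝ

theorem IsPolyhedral.subset_closure_interior {d : ℕ} {s : Set (Euc d)} (hs : IsPolyhedral s) :
    s ⊆ closure (interior s) := by
  obtain ⟨F, -, -, hV, rfl⟩ := hs
  refine Set.iUnion₂_subset fun V hVF => ?_
  have h := (convex_convexHull ℝ V).closure_interior_eq_closure_of_nonempty_interior (hV V hVF).2
  refine subset_closure.trans (h.symm.subset.trans (closure_mono (interior_mono ?_)))
  exact Set.subset_biUnion_of_mem (u := fun V => convexHull ℝ V) hVF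

/-- An elementary finite form of the Baire property: either one closed set contains all of `U`, or
removing it leaves a nonempty open set covered by the others. -/
theorem exists_interior_inter_nonempty {X ι : Type*} [TopologicalSpace X] {F : Set ι}
    (hF : F.Finite) (C : ι → Set X) (hC : ∀ i ∈ F, IsClosed (C i)) :
    ∀ U : Set X, IsOpen U → U.Nonempty → U ⊆ ⋃ i ∈ F, C i →
      ∃ i ∈ F, (interior (C i) ∩ U).Nonempty := by
  induction F, hF using Set.Finite.induction_on with
  | empty =>
    intro U _ hne hsub
    obtain ⟨x, hx⟩ := hne
    simpa using hsub hx
  | @insert i F _ _ ih =>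
    intro U hU hne hsub
    rcases Set.eq_empty_or_nonempty (U \ C i) with h0 | h1
    · obtain ⟨x, hx⟩ := hne
      exact ⟨i, Set.mem_insert _ _, x,
        interior_maximal (Set.sdiff_eq_empty.1 h0) hU hx, hx⟩
    · obtain ⟨j, hj, x, hx, hxU⟩ := ih (fun j hj => hC j (Set.mem_insert_of_mem _ hj)) (U \ C i)
        (hU.sdiff (hC i (Set.mem_insert _ _))) h1 (by
          rintro x ⟨hxU, hxi⟩
          have := hsub hxU
          rw [Set.biUnion_insert] at this
          exact this.resolve_left hxi)
      exact ⟨j, Set.mem_insert_of_mem _ hj, x, hx, hxU.1⟩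

/-- If the `R`-patch of `A` is contained in `B`, then `A` and `B` have the same `r`-patch for
`r < R`. -/
theorem Tiling.rPatch_eq_of_subset {d : ℕ} {L : Type} {A B : Tiling d L} {r R : ℝ} {x : Euc d}
    (hrR : r < R) (h : rPatch A.tiles R x ⊆ B.tiles) :
    rPatch A.tiles r x = rPatch B.tiles r x := by
  refine Set.Subset.antisymm ?_ ?_
  · rintro t ⟨ht, hn⟩
    exact ⟨h ⟨ht, hn.mono (Set.inter_subset_inter_right _
      (Metric.closedBall_subset_closedBall hrR.le))⟩, hn⟩
  rintro t ⟨ht, y, hyt, hyr⟩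
  refine ⟨?_, y, hyt, hyr⟩
  -- The point `y` lies in the open `R`-ball because `r < R`, and it is a limit of interior points
  -- of `t`. Some tile `s` of the finite `R`-patch of `A` then shares an interior point with `t`,
  -- and as both belong to `B`, they coincide.
  have hU : (Metric.ball x R ∩ interior t.support).Nonempty :=
    mem_closure_iff.1 ((B.polyhedral t ht).subset_closure_interior hyt) _ Metric.isOpen_ball
      (lt_of_le_of_lt hyr hrR)
  obtain ⟨s, hs, z, hzs, -, hzt⟩ := exists_interior_inter_nonempty (A.rPatch_finite R x)
    (fun s => s.support) (fun s hs => (A.polyhedral s hs.1).isClosed) _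
    (Metric.isOpen_ball.inter isOpen_interior) hU (by
      rintro z ⟨hzR, -⟩
      have hz : z ∈ ⋃ s ∈ A.tiles, s.support := A.covers ▸ Set.mem_univ z
      obtain ⟨s, hs, hzs⟩ := Set.mem_iUnion₂.1 hz
      exact Set.mem_biUnion ⟨hs, z, hzs, Metric.ball_subset_closedBall hzR⟩ hzs)
  by_cases hst : s = t
  · exact hst ▸ hs.1
  · exact ((B.disjoint s (h hs) t ht hst).le_bot ⟨hzs, hzt⟩).elim

theorem LocallyIndistinguishable.exists_rPatch_eq {d : ℕ} {L : Type} {A T : Tiling d L}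
    (hA : LocallyIndistinguishable A T) (R : ℝ) (x : Euc d) :
    ∃ w : Euc d, rPatch A.tiles R x = rPatch (trans w • T).tiles R x := by
  -- Occurrence only gives an inclusion of patches; the extra unit of radius turns it into equality
  -- at radius `R`.
  obtain ⟨v, hv⟩ := hA _ (rPatch_subset A.tiles (R + 1) x) (A.rPatch_finite _ _)
  refine ⟨-v, Tiling.rPatch_eq_of_subset (lt_add_one R) ?_⟩
  have h : trans (-v) = (trans v)⁻¹ := by
    rw [eq_inv_iff_mul_eq_one, ← trans_add, neg_add_cancel, trans_zero]
  rw [tiles_smul, h]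
  exact Set.smul_set_subset_iff_subset_inv_smul_set.1 hv

/-! ### Derivation of tilings -/

/-- The rule for S-local derivability holds with radius `r`. -/
def DerivesWith {d : ℕ} {L₁ L₂ : Type} (H : Subgroup (Orth d)) (r : ℝ)
    (T₁ : Tiling d L₁) (T₂ : Tiling d L₂) : Prop :=
  ∀ (Φ : Isom d) (x : Euc d), Φ.linearIsometryEquiv ∈ H →
    Φ • rPatch T₁.tiles r x = rPatch T₁.tiles r (Φ x) →
    Φ • rPatch T₂.tiles 1 x = rPatch T₂.tiles 1 (Φ x)

section Derive

variable {d : ℕ} {L₁ L₂ : Type} {H : Subgroup (Orth d)} {r : ℝ} {T₁ : Tiling d L₁}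
  {T₂ : Tiling d L₂}

/-- The isometry `Ψ⁻¹ * Φ` matches the `r`-patches of `T₁` at the preimages of `y`, so the rule
applies to it. In this form the rule compares two placed copies at one point. -/
theorem DerivesWith.rPatch_one_eq (h : DerivesWith H r T₁ T₂) {Φ Ψ : Isom d}
    (hΦ : Φ.linearIsometryEquiv ∈ H) (hΨ : Ψ.linearIsometryEquiv ∈ H) {y : Euc d}
    (hp : rPatch (Φ • T₁).tiles r y = rPatch (Ψ • T₁).tiles r y) :
    rPatch (Φ • T₂).tiles 1 y = rPatch (Ψ • T₂).tiles 1 y := by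
  have hΦy : Φ (Φ⁻¹ y) = y := Φ.apply_symm_apply y
  have hΨy : Ψ (Ψ⁻¹ y) = y := Ψ.apply_symm_apply y
  have e (L : Type) (T : Tiling d L) (Θ : Isom d) (hΘ : Θ (Θ⁻¹ y) = y) (s : ℝ) :
      rPatch (Θ • T).tiles s y = Θ • rPatch T.tiles s (Θ⁻¹ y) := by
    rw [← rPatch_smul, hΘ, tiles_smul]
  rw [e _ _ Φ hΦy, e _ _ Ψ hΨy] at hp ⊢
  have hpt : (Ψ⁻¹ * Φ) (Φ⁻¹ y) = Ψ⁻¹ y := congrArg (fun z => Ψ⁻¹ z) hΦy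
  have key := h (Ψ⁻¹ * Φ) (Φ⁻¹ y)
    (by rw [linear_mul, linear_inv]; exact H.mul_mem (H.inv_mem hΨ) hΦ)
    (by rw [hpt, mul_smul, hp, inv_smul_smul])
  rw [hpt, mul_smul, inv_smul_eq_iff] at key
  exact key

/-- A tile that meets the `R`-ball at `y` is visible in the `1`-patch at `y`, and the `r`-ball about
`y` lies in the `(R + r)`-ball about `x`. -/
theorem DerivesWith.rPatch_eq (h : DerivesWith H r T₁ T₂) {Φ Ψ : Isom d}
    (hΦ : Φ.linearIsometryEquiv ∈ H) (hΨ : Ψ.linearIsometryEquiv ∈ H) {R : ℝ} {x : Euc d}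
    (hp : rPatch (Φ • T₁).tiles (R + r) x = rPatch (Ψ • T₁).tiles (R + r) x) :
    rPatch (Φ • T₂).tiles R x = rPatch (Ψ • T₂).tiles R x := by
  have key (Φ Ψ : Isom d) (hΦ : Φ.linearIsometryEquiv ∈ H) (hΨ : Ψ.linearIsometryEquiv ∈ H)
      (hp : rPatch (Φ • T₁).tiles (R + r) x = rPatch (Ψ • T₁).tiles (R + r) x) :
      rPatch (Φ • T₂).tiles R x ⊆ rPatch (Ψ • T₂).tiles R x := by
    rintro t ⟨ht, y, hyt, hyR⟩
    have hyR' : dist y x ≤ R := hyR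
    have h1 := h.rPatch_one_eq hΦ hΨ (rPatch_eq_of_closedBall (s := r) (y := y) (by linarith) hp)
    have h2 : t ∈ rPatch (Φ • T₂).tiles 1 y :=
      ⟨ht, y, hyt, Metric.mem_closedBall_self zero_le_one⟩
    rw [h1] at h2
    exact ⟨h2.1, y, hyt, hyR⟩
  exact (key Φ Ψ hΦ hΨ hp).antisymm (key Ψ Φ hΨ hΦ hp.symm)

/-- The tiles derived from a set of tiles which locally looks like `T₁`. -/
def deriveTiles (H : Subgroup (Orth d)) (r : ℝ) (T₁ : Tiling d L₁) (T₂ : Tiling d L₂)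
    (A : Set (Tile d L₁)) : Set (Tile d L₂) :=
  {t | ∃ (Φ : Isom d) (x : Euc d), Φ.linearIsometryEquiv ∈ H ∧
    rPatch A r x = rPatch (Φ • T₁).tiles r x ∧ t ∈ rPatch (Φ • T₂).tiles 1 x}

/-- The derived tiles are independent of the placements that produce them. A tile may be produced at
a centre `z` far from the point `y` where it meets the `R`-ball; a single translate of `T₁` matching
`A` around both points links the two placements. -/
theorem DerivesWith.rPatch_deriveTiles (h : DerivesWith H r T₁ T₂) {A : Tiling d L₁}
    (hA : LocallyIndistinguishable A T₁) {Φ : Isom d} (hΦ : Φ.linearIsometryEquiv ∈ H) {R : ℝ}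
    {x : Euc d} (hp : rPatch A.tiles (R + r) x = rPatch (Φ • T₁).tiles (R + r) x) :
    rPatch (deriveTiles H r T₁ T₂ A.tiles) R x = rPatch (Φ • T₂).tiles R x := by
  refine Set.Subset.antisymm ?_ ?_
  · rintro t ⟨⟨Ψ, z, hΨ, hpz, ht⟩, y, hyt, hyR⟩
    have hyR' : dist y x ≤ R := hyR
    refine ⟨?_, y, hyt, hyR⟩
    -- This radius covers the `r`-balls about `z` and `y`. At `z` the placement `Ψ` is exchanged for
    -- the translate by `w`, and at `y` that translate is exchanged for `Φ`.
    obtain ⟨w, hw⟩ := hA.exists_rPatch_eq (R + r + dist z x) x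
    have hw' := linear_trans_mem H w
    have hz := h.rPatch_one_eq hΨ hw' (hpz.symm.trans
      (rPatch_eq_of_closedBall (s := r) (y := z)
        (by linarith [dist_nonneg.trans hyR']) hw))
    have hy := h.rPatch_one_eq hw' hΦ ((rPatch_eq_of_closedBall (s := r) (y := y)
      (by linarith [dist_nonneg (x := z) (y := x)]) hw).symm.trans
      (rPatch_eq_of_closedBall (s := r) (y := y) (by linarith) hp))
    rw [hz] at ht
    have hty : t ∈ rPatch (trans w • T₂).tiles 1 y :=
      ⟨ht.1, y, hyt, Metric.mem_closedBall_self zero_le_one⟩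
    rw [hy] at hty
    exact hty.1
  · rintro t ⟨ht, y, hyt, hyR⟩
    have hyR' : dist y x ≤ R := hyR
    exact ⟨⟨Φ, y, hΦ, rPatch_eq_of_closedBall (by linarith) hp, ht, y, hyt,
      Metric.mem_closedBall_self zero_le_one⟩, y, hyt, hyR⟩

/-- Since a bounded region of the derived set is a piece of a translate of `T₂`, the axioms of a
tiling can be read off there. -/
theorem DerivesWith.exists_rPatch_deriveTiles (h : DerivesWith H r T₁ T₂) {A : Tiling d L₁}
    (hA : LocallyIndistinguishable A T₁) (R : ℝ) (x : Euc d) :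
    ∃ w : Euc d, rPatch (deriveTiles H r T₁ T₂ A.tiles) R x = rPatch (trans w • T₂).tiles R x := by
  obtain ⟨w, hw⟩ := hA.exists_rPatch_eq (R + r) x
  exact ⟨w, h.rPatch_deriveTiles hA (linear_trans_mem H w) hw⟩

theorem exists_mem_support_of_mem_deriveTiles {A : Set (Tile d L₁)} {t : Tile d L₂}
    (ht : t ∈ deriveTiles H r T₁ T₂ A) : ∃ y, y ∈ t.support := by
  obtain ⟨Φ, x, -, -, -, y, hy, -⟩ := ht
  exact ⟨y, hy⟩

/-- The tiling derived from a tiling in the hull of `T₁`. -/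
def DerivesWith.tiling (h : DerivesWith H r T₁ T₂) {A : Tiling d L₁}
    (hA : LocallyIndistinguishable A T₁) : Tiling d L₂ where
  tiles := deriveTiles H r T₁ T₂ A.tiles
  polyhedral t ht := by
    obtain ⟨y, hy⟩ := exists_mem_support_of_mem_deriveTiles ht
    obtain ⟨w, hw⟩ := h.exists_rPatch_deriveTiles hA 0 y
    have h1 : t ∈ rPatch (deriveTiles H r T₁ T₂ A.tiles) 0 y :=
      ⟨ht, y, hy, Metric.mem_closedBall_self le_rfl⟩
    rw [hw] at h1
    exact (trans w • T₂).polyhedral t h1.1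
  covers := by
    refine Set.eq_univ_of_forall fun x => ?_
    obtain ⟨w, hw⟩ := h.exists_rPatch_deriveTiles hA 0 x
    have hx : x ∈ ⋃ t ∈ (trans w • T₂).tiles, t.support :=
      (trans w • T₂).covers ▸ Set.mem_univ x
    obtain ⟨t, ht, hxt⟩ := Set.mem_iUnion₂.1 hx
    have h1 : t ∈ rPatch (trans w • T₂).tiles 0 x :=
      ⟨ht, x, hxt, Metric.mem_closedBall_self le_rfl⟩
    rw [← hw] at h1
    exact Set.mem_biUnion h1.1 hxt
  disjoint s hs t ht hst := by
    obtain ⟨y, hy⟩ := exists_mem_support_of_mem_deriveTiles hs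
    obtain ⟨z, hz⟩ := exists_mem_support_of_mem_deriveTiles ht
    -- This radius puts both tiles into one patch, hence into one translate of `T₂`.
    obtain ⟨w, hw⟩ := h.exists_rPatch_deriveTiles hA (dist z y) y
    have h1 : s ∈ rPatch (deriveTiles H r T₁ T₂ A.tiles) (dist z y) y :=
      ⟨hs, y, hy, Metric.mem_closedBall_self dist_nonneg⟩
    have h2 : t ∈ rPatch (deriveTiles H r T₁ T₂ A.tiles) (dist z y) y :=
      ⟨ht, z, hz, Metric.mem_closedBall.2 le_rfl⟩
    rw [hw] at h1 h2
    exact (trans w • T₂).disjoint s h1.1 t h2.1 hst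
  prototiles := by
    obtain ⟨F, hF, hp⟩ := T₂.prototiles
    refine ⟨F, hF, fun t ht => ?_⟩
    obtain ⟨y, hy⟩ := exists_mem_support_of_mem_deriveTiles ht
    obtain ⟨w, hw⟩ := h.exists_rPatch_deriveTiles hA 0 y
    have h1 : t ∈ rPatch (deriveTiles H r T₁ T₂ A.tiles) 0 y :=
      ⟨ht, y, hy, Metric.mem_closedBall_self le_rfl⟩
    rw [hw] at h1
    obtain ⟨s, hs, hst⟩ := h1.1
    obtain ⟨p, hpF, v, rfl⟩ := hp s hs
    exact ⟨p, hpF, w + v, by rw [trans_add, mul_smul]; exact hst.symm⟩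

theorem DerivesWith.locallyIndistinguishable (h : DerivesWith H r T₁ T₂) {A : Tiling d L₁}
    (hA : LocallyIndistinguishable A T₁) : LocallyIndistinguishable (h.tiling hA) T₂ := by
  intro P hP hfin
  obtain ⟨R, -, hR⟩ := (h.tiling hA).exists_subset_rPatch hP hfin
  obtain ⟨w, hw⟩ := h.exists_rPatch_deriveTiles hA R 0
  refine ⟨-w, ?_⟩
  have h1 : P ⊆ trans w • T₂.tiles := hR.trans (hw.subset.trans (rPatch_subset _ _ _))
  rw [Set.smul_set_subset_iff_subset_inv_smul_set]
  have e : (trans (-w))⁻¹ = trans w := by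
    rw [inv_eq_iff_mul_eq_one, ← trans_add, neg_add_cancel, trans_zero]
  rwa [e]

-- The map of hulls: base points, inverses, continuity

/-- The map of hulls induced by a derivation. -/
def DerivesWith.hullMap (h : DerivesWith H r T₁ T₂) (A : Hull T₁) : Hull T₂ :=
  ⟨h.tiling A.2, h.locallyIndistinguishable A.2⟩

theorem DerivesWith.rPatch_hullMap (h : DerivesWith H r T₁ T₂) (A : Hull T₁) {Φ : Isom d}
    (hΦ : Φ.linearIsometryEquiv ∈ H) {R : ℝ} {x : Euc d}
    (hp : rPatch A.1.tiles (R + r) x = rPatch (Φ • T₁).tiles (R + r) x) :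
    rPatch (h.hullMap A).1.tiles R x = rPatch (Φ • T₂).tiles R x :=
  h.rPatch_deriveTiles A.2 hΦ hp

theorem DerivesWith.hullMap_base (h : DerivesWith H r T₁ T₂) :
    h.hullMap (Hull.base T₁) = Hull.base T₂ := by
  refine Subtype.ext (tiles_eq_of_rPatch_eq fun R _ => ?_)
  have key := h.rPatch_hullMap (Hull.base T₁) (linear_trans_mem H 0) (R := R) (x := 0)
    (by rw [trans_zero, one_smul]; rfl)
  rwa [trans_zero, one_smul] at key

theorem DerivesWith.hullMap_hullMap (h : DerivesWith H r T₁ T₂) {r' : ℝ}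
    (h' : DerivesWith H r' T₂ T₁) (A : Hull T₁) : h'.hullMap (h.hullMap A) = A := by
  refine Subtype.ext (tiles_eq_of_rPatch_eq fun R _ => ?_)
  -- The two derivations use up `r` and then `r'`. The maximum with `R` is needed because no sign is
  -- assumed for these radii.
  obtain ⟨w, hw⟩ := A.2.exists_rPatch_eq (max R (R + r' + r)) 0
  have hm := linear_trans_mem H w
  rw [h'.rPatch_hullMap _ hm (h.rPatch_hullMap _ hm (rPatch_eq_of_le (le_max_right _ _) hw))]
  exact (rPatch_eq_of_le (le_max_left _ _) hw).symm

theorem DerivesWith.rPatch_hullMap_eq (h : DerivesWith H r T₁ T₂) {A B : Hull T₁} {R : ℝ}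
    {x : Euc d} (hAB : rPatch A.1.tiles (R + r) x = rPatch B.1.tiles (R + r) x) :
    rPatch (h.hullMap A).1.tiles R x = rPatch (h.hullMap B).1.tiles R x := by
  obtain ⟨w, hw⟩ := A.2.exists_rPatch_eq (R + r) x
  have hm := linear_trans_mem H w
  rw [h.rPatch_hullMap A hm hw, h.rPatch_hullMap B hm (hAB.symm.trans hw)]

/-- The small motion that matches `B` with `A` also matches their images, at a radius smaller by
`r`. It involves a rotation, so `H` must contain `SO d`. -/
theorem DerivesWith.continuous_hullMap (h : DerivesWith H r T₁ T₂) (hr : 0 < r)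
    (hH : SO d ≤ H) : Continuous h.hullMap := by
  refine ⟨fun U hU A hA => ?_⟩
  obtain ⟨ε, hε, hεU⟩ := hU _ hA
  have hpos : 0 < 1 / ε + r := by positivity
  have hle : 1 / (1 / ε + r) ≤ ε := by
    rw [div_le_iff₀ hpos, mul_add, mul_one_div_cancel hε.ne']
    have := mul_pos hε hr
    linarith
  -- The reciprocal of this number is `1 / ε + r`, which leaves agreement to radius `1 / ε` after
  -- the derivation.
  refine ⟨1 / (1 / ε + r), one_div_pos.2 hpos, fun B hB => hεU _ ?_⟩
  obtain ⟨v, g, hv, hg, hgx, hp⟩ := hB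
  refine ⟨v, g, hv.trans hle, hg,
    fun x => (hgx x).trans (mul_le_mul_of_nonneg_right hle (norm_nonneg x)), ?_⟩
  rw [one_div_one_div] at hp
  -- The motion carries `x` to the origin, so `B` is compared with a translate of `T₁` about `x`.
  set x := (rot g * trans v)⁻¹ 0
  have hx0 : (rot g * trans v) x = 0 := (rot g * trans v).apply_symm_apply 0
  obtain ⟨w, hw⟩ := B.2.exists_rPatch_eq (1 / ε + r) x
  have hB' := rPatch_smul_eq (rot g * trans v) (h.rPatch_hullMap B (linear_trans_mem H w) hw)
  have hw' := rPatch_smul_eq (rot g * trans v) hw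
  rw [hx0, mul_smul, ← tiles_smul, ← tiles_smul, hp, ← tiles_smul, smul_smul] at hw'
  rw [hx0, ← tiles_smul, ← tiles_smul, smul_smul, mul_smul (rot g) (trans v)] at hB'
  refine (hB'.trans (h.rPatch_hullMap A ?_ hw').symm)
  rw [linear_mul, linear_mul, linear_trans, linear_trans, linear_rot, mul_one, mul_one]
  exact hH hg

-- Symmetries under derivation

/-- About the origin `g(T₁)` agrees with a translate of `T₁`; by the rule, `g(T₂)` agrees there with
the same translate of `T₂`. -/
theorem DerivesWith.acts (h : DerivesWith H r T₁ T₂) {g : Orth d} (hg : g ∈ H)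
    (hact : Acts g T₁) : Acts g T₂ := by
  intro P hP hfin
  obtain ⟨R, -, hR⟩ := T₂.exists_subset_rPatch hP hfin
  obtain ⟨w, hw⟩ := ((LocallyIndistinguishable.refl T₁).rot hact).exists_rPatch_eq (R + r) 0
  have key := h.rPatch_eq (Φ := rot g) (by rwa [linear_rot]) (linear_trans_mem H w) hw
  rw [rPatch_rot_zero] at key
  have h1 : rot g • P ⊆ trans w • T₂.tiles :=
    (Set.smul_set_mono hR).trans (key.subset.trans (rPatch_subset _ _ _))
  refine ⟨-w, ?_⟩
  rw [Set.smul_set_subset_iff_subset_inv_smul_set]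
  have e : (trans (-w))⁻¹ = trans w := by
    rw [inv_eq_iff_mul_eq_one, ← trans_add, neg_add_cancel, trans_zero]
  rwa [e]

theorem DerivesWith.mem_actingGroup (h : DerivesWith H r T₁ T₂) {g : Orth d}
    (hg : g ∈ actingGroup H T₁) : g ∈ actingGroup H T₂ :=
  ⟨hg.1, h.acts hg.1 hg.2.1, h.acts (H.inv_mem hg.1) hg.2.2⟩

/-- If `A` looks like `trans w • T₁` near the origin, then `g • A` looks like `(rot g * trans w) •
T₁`. This placement has linear part `g` in `H`, so it computes the derived tiling of `g • A`. -/
theorem DerivesWith.hullMap_smul (h : DerivesWith H r T₁ T₂) (g : actingGroup H T₁)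
    (A : Hull T₁) :
    h.hullMap (g • A) = (⟨g.1, h.mem_actingGroup g.2⟩ : actingGroup H T₂) • h.hullMap A := by
  refine Subtype.ext (tiles_eq_of_rPatch_eq fun R _ => ?_)
  obtain ⟨w, hw⟩ := A.2.exists_rPatch_eq (R + r) 0
  have e : rot g.1 (0 : Euc d) = 0 := map_zero g.1
  have h1 := rPatch_smul_eq (rot g.1) hw
  have h2 := rPatch_smul_eq (rot g.1) (h.rPatch_hullMap A (linear_trans_mem H w) hw)
  rw [e, ← tiles_smul, ← tiles_smul, smul_smul] at h1 h2
  refine (h.rPatch_hullMap (g • A) ?_ h1).trans h2.symm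
  rw [linear_mul, linear_trans, linear_rot, mul_one]
  exact g.2.1

end Derive

/-! ### Pro-groups -/

/-- A family of homomorphisms which commutes with the structure maps far enough along the first
inverse system is represented by a morphism of pro-groups. -/
theorem ProGroup.exists_hom {P Q : ProGroup} (k : ℕ → ℕ) (a : ∀ n, P.obj (k n) →* Q.obj n)
    (comm : ∀ {m n : ℕ} (h : m ≤ n), ∃ (K : ℕ) (h₁ : k n ≤ K) (h₂ : k m ≤ K), ∀ x : P.obj K,
      Q.map h (a n (P.map h₁ x)) = a m (P.map h₂ x)) :
    ∃ (f : P.Hom Q) (hk : ∀ n, k n ≤ f.idx n), ∀ (n : ℕ) (x : P.obj (f.idx n)),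
      f.app n x = a n (P.map (hk n) x) := by
  -- Bounds are given to all pairs, including those out of order, so that `K` becomes a plain
  -- function.
  have total (q : ℕ × ℕ) : ∃ (K : ℕ) (h₁ : k q.2 ≤ K) (h₂ : k q.1 ≤ K), ∀ (h : q.1 ≤ q.2)
      (x : P.obj K), Q.map h (a q.2 (P.map h₁ x)) = a q.1 (P.map h₂ x) := by
    by_cases h : q.1 ≤ q.2
    · obtain ⟨K, h₁, h₂, hK⟩ := comm h
      exact ⟨K, h₁, h₂, fun _ => hK⟩
    · exact ⟨max (k q.2) (k q.1), le_max_left _ _, le_max_right _ _, fun h' => (h h').elim⟩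
  choose K h₁ h₂ hK using total
  -- The supremum over all pairs of indices up to and including `n` makes `idx` monotone and beyond
  -- every bound needed at level `n`.
  let idx (n : ℕ) : ℕ := (Finset.range (n + 1) ×ˢ Finset.range (n + 1)).sup K
  have hle {m n : ℕ} (h : m ≤ n) : K (m, n) ≤ idx n := by
    refine Finset.le_sup (f := K) (Finset.mem_product.2 ⟨Finset.mem_range.2 ?_, ?_⟩)
    · exact Nat.lt_succ_of_le h
    · exact Finset.mem_range.2 (Nat.lt_succ_self n)
  have hk (n : ℕ) : k n ≤ idx n := (h₁ (n, n)).trans (hle le_rfl)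
  have hmono : Monotone idx := fun m n h => by
    have hr : Finset.range (m + 1) ⊆ Finset.range (n + 1) :=
      Finset.range_subset_range.2 (Nat.succ_le_succ h)
    exact Finset.sup_mono (Finset.product_subset_product hr hr)
  refine ⟨⟨idx, hmono, fun n => (a n).comp (P.map (hk n)), ?_⟩, hk, fun n x => rfl⟩
  intro m n h x
  have key := hK (m, n) h (P.map (hle h) x)
  rw [P.map_map, P.map_map] at key
  change Q.map h (a n (P.map (hk n) x)) = a m (P.map (hk m) (P.map (hmono h) x))
  rw [P.map_map]
  exact key

/-- Families of homomorphisms in both directions which commute with the structure maps, and are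
mutually inverse, far enough along the inverse systems give a pro-equivalence. -/
theorem ProGroup.Equiv.of_eventually {P Q : ProGroup}
    (k : ℕ → ℕ) (a : ∀ n, P.obj (k n) →* Q.obj n) (l : ℕ → ℕ) (b : ∀ n, Q.obj (l n) →* P.obj n)
    (ha : ∀ {m n : ℕ} (h : m ≤ n), ∃ (K : ℕ) (h₁ : k n ≤ K) (h₂ : k m ≤ K), ∀ x : P.obj K,
      Q.map h (a n (P.map h₁ x)) = a m (P.map h₂ x))
    (hb : ∀ {m n : ℕ} (h : m ≤ n), ∃ (K : ℕ) (h₁ : l n ≤ K) (h₂ : l m ≤ K), ∀ x : Q.obj K,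
      P.map h (b n (Q.map h₁ x)) = b m (Q.map h₂ x))
    (hba : ∀ n, ∃ (K : ℕ) (h₁ : k (l n) ≤ K) (h₂ : n ≤ K), ∀ x : P.obj K,
      b n (a (l n) (P.map h₁ x)) = P.map h₂ x)
    (hab : ∀ n, ∃ (K : ℕ) (h₁ : l (k n) ≤ K) (h₂ : n ≤ K), ∀ x : Q.obj K,
      a n (b (k n) (Q.map h₁ x)) = Q.map h₂ x) : P.Equiv Q := by
  have comp {P Q : ProGroup} (f : P.Hom Q) (g : Q.Hom P)
      (k : ℕ → ℕ) (a : ∀ n, P.obj (k n) →* Q.obj n) (l : ℕ → ℕ)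
      (b : ∀ n, Q.obj (l n) →* P.obj n)
      (hk : ∀ n, k n ≤ f.idx n)
      (hf : ∀ (n : ℕ) (x : P.obj (f.idx n)), f.app n x = a n (P.map (hk n) x))
      (hl : ∀ n, l n ≤ g.idx n)
      (hg : ∀ (n : ℕ) (x : Q.obj (g.idx n)), g.app n x = b n (Q.map (hl n) x))
      (hba : ∀ n, ∃ (K : ℕ) (h₁ : k (l n) ≤ K) (h₂ : n ≤ K), ∀ x : P.obj K,
        b n (a (l n) (P.map h₁ x)) = P.map h₂ x) (n : ℕ) :
      ∃ (K : ℕ) (h : n ≤ K) (h' : f.idx (g.idx n) ≤ K), ∀ x : P.obj K,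
        g.app n (f.app (g.idx n) (P.map h' x)) = P.map h x := by
    obtain ⟨K, h₁, h₂, hK⟩ := hba n
    refine ⟨max K (f.idx (g.idx n)), h₂.trans (le_max_left _ _), le_max_right _ _, fun x => ?_⟩
    rw [hg, f.comm, hf, P.map_map, P.map_map]
    have key := hK (P.map (le_max_left _ _) x)
    rwa [P.map_map, P.map_map] at key
  obtain ⟨f, hk, hf⟩ := ProGroup.exists_hom k a ha
  obtain ⟨g, hl, hg⟩ := ProGroup.exists_hom l b hb
  exact ⟨f, g, comp f g k a l b hk hf hl hg hba, comp g f l b k a hl hg hk hf hab⟩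

theorem ProGroup.Equiv.symm {P Q : ProGroup} (h : P.Equiv Q) : Q.Equiv P := by
  obtain ⟨f, g, hgf, hfg⟩ := h
  exact ⟨g, f, hfg, hgf⟩

/-- Composition of morphisms of pro-groups. -/
def ProGroup.Hom.comp {P Q R : ProGroup} (g : Q.Hom R) (f : P.Hom Q) : P.Hom R where
  idx n := f.idx (g.idx n)
  mono := f.mono.comp g.mono
  app n := (g.app n).comp (f.app (g.idx n))
  comm h x := by
    change R.map h (g.app _ (f.app _ x)) = g.app _ (f.app _ (P.map _ x))
    rw [g.comm h, f.comm (g.mono h)]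

theorem ProGroup.Equiv.trans {P Q R : ProGroup} (h : P.Equiv Q) (h' : Q.Equiv R) :
    P.Equiv R := by
  have comp {P Q R : ProGroup} (f : P.Hom Q) (g : Q.Hom P) (f' : Q.Hom R) (g' : R.Hom Q)
      (hgf : ∀ n, ∃ (k : ℕ) (h : n ≤ k) (h' : f.idx (g.idx n) ≤ k), ∀ x : P.obj k,
        g.app n (f.app (g.idx n) (P.map h' x)) = P.map h x)
      (hgf' : ∀ n, ∃ (k : ℕ) (h : n ≤ k) (h' : f'.idx (g'.idx n) ≤ k), ∀ x : Q.obj k,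
        g'.app n (f'.app (g'.idx n) (Q.map h' x)) = Q.map h x) (n : ℕ) :
      ∃ (k : ℕ) (h : n ≤ k) (h' : (f'.comp f).idx ((g.comp g').idx n) ≤ k), ∀ x : P.obj k,
        (g.comp g').app n ((f'.comp f).app ((g.comp g').idx n) (P.map h' x)) = P.map h x := by
    obtain ⟨k, h₁, h₂, hk⟩ := hgf n
    obtain ⟨l, h₃, h₄, hl⟩ := hgf' (g.idx n)
    let K := max (max k (f.idx l)) (f.idx (f'.idx (g'.idx (g.idx n))))
    have hkK : k ≤ K := (le_max_left _ _).trans (le_max_left _ _)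
    have hlK : f.idx l ≤ K := (le_max_right _ _).trans (le_max_left _ _)
    refine ⟨K, h₁.trans hkK, le_max_right _ _, fun x => ?_⟩
    change g.app n (g'.app _ (f'.app _ (f.app _ (P.map _ x)))) = _
    -- Passing through `f` at level `l` brings the argument to where `g'` after `f'` is a structure
    -- map of `Q`; what remains is the relation for `g` after `f`.
    have e : f.app (f'.idx (g'.idx (g.idx n))) (P.map (le_max_right _ _) x)
        = Q.map h₄ (f.app l (P.map hlK x)) := by
      rw [f.comm h₄, P.map_map]
    rw [e, hl, f.comm, P.map_map]
    have key := hk (P.map hkK x)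
    rwa [P.map_map, P.map_map] at key
  obtain ⟨f, g, hgf, hfg⟩ := h
  obtain ⟨f', g', hgf', hfg'⟩ := h'
  exact ⟨f'.comp f, g.comp g', comp f g f' g' hgf hgf', comp g' f' g f hfg' hfg⟩

/-- The homomorphism of inverse limits induced by a morphism of pro-groups. -/
def ProGroup.Hom.lim {P Q : ProGroup} (f : P.Hom Q) : P.lim →* Q.lim where
  toFun x := ⟨fun n => f.app n (x.1 (f.idx n)), fun h => by rw [f.comm h, x.2]⟩
  map_one' := Subtype.ext (funext fun n => map_one (f.app n))
  map_mul' x y := Subtype.ext (funext fun n => map_mul (f.app n) _ _)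

theorem ProGroup.Equiv.lim_mulEquiv {P Q : ProGroup} (h : P.Equiv Q) :
    Nonempty (P.lim ≃* Q.lim) := by
  obtain ⟨f, g, hgf, hfg⟩ := h
  have key {P Q : ProGroup} (f : P.Hom Q) (g : Q.Hom P)
      (hgf : ∀ n, ∃ (k : ℕ) (h : n ≤ k) (h' : f.idx (g.idx n) ≤ k), ∀ x : P.obj k,
        g.app n (f.app (g.idx n) (P.map h' x)) = P.map h x) :
      g.lim.comp f.lim = MonoidHom.id _ := by
    ext x n
    -- The relation at the late stage `k` is evaluated on the coordinate `x.1 k`; compatibility of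
    -- the thread turns it into an equality at `n`.
    obtain ⟨k, h, h', hk⟩ := hgf n
    have e := hk (x.1 k)
    rw [x.2, x.2] at e
    exact e
  exact ⟨f.lim.toMulEquiv g.lim (key f g hgf) (key g f hfg)⟩

/-! ### Induced maps of fundamental groups -/

theorem mapOfEq_mapOfEq {X Y Z : Type} [TopologicalSpace X] [TopologicalSpace Y]
    [TopologicalSpace Z] {x : X} {y : Y} {z : Z} (f : C(X, Y)) (g : C(Y, Z)) (hf : f x = y)
    (hg : g y = z) (hgf : (g.comp f) x = z) (a : FundamentalGroup X x) :
    FundamentalGroup.mapOfEq g hg (FundamentalGroup.mapOfEq f hf a)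
      = FundamentalGroup.mapOfEq (g.comp f) hgf a := by
  refine (FundamentalGroup.mapOfEq_apply _ _ _).trans ?_
  rw [FundamentalGroup.mapOfEq_apply]
  refine Eq.trans ?_ (FundamentalGroup.mapOfEq_apply _ _ a).symm
  induction a using Path.Homotopic.Quotient.ind with
  | mk p => rfl

theorem mapOfEq_congr {X Y : Type} [TopologicalSpace X] [TopologicalSpace Y] {x : X} {y : Y}
    {f g : C(X, Y)} (h : f.HomotopicRel g {x}) (hf : f x = y) (hg : g x = y)
    (a : FundamentalGroup X x) :
    FundamentalGroup.mapOfEq f hf a = FundamentalGroup.mapOfEq g hg a := by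
  refine (FundamentalGroup.mapOfEq_apply _ _ _).trans ?_
  refine Eq.trans ?_ (FundamentalGroup.mapOfEq_apply _ _ a).symm
  obtain ⟨F⟩ := h
  induction a using Path.Homotopic.Quotient.ind with
  | mk p =>
    refine Quotient.sound ⟨?_⟩
    refine
      { toFun := fun q => F (q.1, p q.2)
        continuous_toFun := F.continuous.comp
          (continuous_fst.prodMk (p.continuous.comp continuous_snd))
        map_zero_left := fun t => F.apply_zero _
        map_one_left := fun t => F.apply_one _
        prop' := ?_ }
    rintro t s (rfl | rfl)
    · exact (F.eq_fst t (x := p 0) p.source :)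
    · exact (F.eq_fst t (x := p 1) p.target :)

/-! ### Uniqueness of expansions -/

section Expansion

variable {X : Type} [TopologicalSpace X] {x : X} {S S' : PointedTower}
  {p : ∀ n, C(X, S.obj n)} {p' : ∀ n, C(X, S'.obj n)}

/-- Both maps are pulled back to the stage `max k k'`. There they agree on `X` up to pointed
homotopy, and the uniqueness clause makes them homotopic at a later stage. -/
theorem IsExpansion.exists_mapOfEq_eq (hS : IsExpansion x S p) {Y : Type} [TopologicalSpace Y]
    (hY : IsCW Y) {y : Y} {k k' : ℕ} (u : C(S.obj k, Y)) (u' : C(S.obj k', Y))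
    (hu : u (S.pt k) = y) (hu' : u' (S.pt k') = y)
    (h : (u.comp (p k)).HomotopicRel (u'.comp (p k')) {x}) :
    ∃ (K : ℕ) (h₁ : k ≤ K) (h₂ : k' ≤ K), ∀ a : S.proPi1.obj K,
      FundamentalGroup.mapOfEq u hu (S.proPi1.map h₁ a)
        = FundamentalGroup.mapOfEq u' hu' (S.proPi1.map h₂ a) := by
  have h₁ := le_max_left k k'
  have h₂ := le_max_right k k'
  obtain ⟨K, hK, e⟩ := hS.unique Y hY (max k k') (u.comp (S.map h₁)) (u'.comp (S.map h₂))
    (((hS.comm h₁).comp_continuousMap u).trans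
      (h.trans ((hS.comm h₂).comp_continuousMap u').symm))
  refine ⟨K, h₁.trans hK, h₂.trans hK, fun a => ?_⟩
  have q₁ : (u.comp (S.map h₁)) (S.pt _) = y := (congrArg u (S.map_pt h₁)).trans hu
  have q₂ : (u'.comp (S.map h₂)) (S.pt _) = y := (congrArg u' (S.map_pt h₂)).trans hu'
  have q₃ : ((u.comp (S.map h₁)).comp (S.map hK)) (S.pt K) = y :=
    (congrArg (u.comp (S.map h₁)) (S.map_pt hK)).trans q₁
  have q₄ : ((u'.comp (S.map h₂)).comp (S.map hK)) (S.pt K) = y :=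
    (congrArg (u'.comp (S.map h₂)) (S.map_pt hK)).trans q₂
  rw [← S.proPi1.map_map h₁ hK, ← S.proPi1.map_map h₂ hK]
  refine (mapOfEq_mapOfEq (S.map h₁) u (S.map_pt h₁) hu q₁ _).trans ?_
  refine ((mapOfEq_mapOfEq (S.map hK) _ (S.map_pt hK) q₁ q₃ a).trans ?_).trans
    (mapOfEq_mapOfEq (S.map h₂) u' (S.map_pt h₂) hu' q₂ _).symm
  exact (mapOfEq_congr e q₃ q₄ a).trans
    (mapOfEq_mapOfEq (S.map hK) _ (S.map_pt hK) q₂ q₄ a).symm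

/-- The towers of fundamental groups of two expansions of a pointed space are pro-equivalent. -/
theorem IsExpansion.proPi1_equiv (hS : IsExpansion x S p) (hS' : IsExpansion x S' p') :
    S.proPi1.Equiv S'.proPi1 := by
  -- A factorisation is not required to be pointed, but a homotopy relative to `x` forces its value
  -- at the base point.
  have pointed {S S' : PointedTower} {p : ∀ n, C(X, S.obj n)} {p' : ∀ n, C(X, S'.obj n)}
      (hS : IsExpansion x S p) (hS' : IsExpansion x S' p') {n k : ℕ} (g : C(S.obj k, S'.obj n))
      (h : (g.comp (p k)).HomotopicRel (p' n) {x}) : g (S.pt k) = S'.pt n := by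
    have e := h.fst_eq_snd (Set.mem_singleton x)
    rwa [ContinuousMap.comp_apply, hS.pt, hS'.pt] at e
  have comm {S S' : PointedTower} {p : ∀ n, C(X, S.obj n)} {p' : ∀ n, C(X, S'.obj n)}
      (hS : IsExpansion x S p) (hS' : IsExpansion x S' p') (k : ℕ → ℕ)
      (g : ∀ n, C(S.obj (k n), S'.obj n)) (hpt : ∀ n, g n (S.pt (k n)) = S'.pt n)
      (h : ∀ n, ((g n).comp (p (k n))).HomotopicRel (p' n) {x}) {m n : ℕ} (hmn : m ≤ n) :
      ∃ (K : ℕ) (h₁ : k n ≤ K) (h₂ : k m ≤ K), ∀ a : S.proPi1.obj K,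
        S'.proPi1.map hmn (FundamentalGroup.mapOfEq (g n) (hpt n) (S.proPi1.map h₁ a))
          = FundamentalGroup.mapOfEq (g m) (hpt m) (S.proPi1.map h₂ a) := by
    have q : ((S'.map hmn).comp (g n)) (S.pt (k n)) = S'.pt m :=
      (congrArg (S'.map hmn) (hpt n)).trans (S'.map_pt hmn)
    obtain ⟨K, h₁, h₂, hK⟩ := hS.exists_mapOfEq_eq (hS'.cw m) ((S'.map hmn).comp (g n)) (g m)
      q (hpt m) (((h n).comp_continuousMap (S'.map hmn)).trans ((hS'.comm hmn).trans (h m).symm))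
    exact ⟨K, h₁, h₂, fun a => (mapOfEq_mapOfEq (g n) _ (hpt n) (S'.map_pt hmn) q _).trans (hK a)⟩
  have inv {S S' : PointedTower} {p : ∀ n, C(X, S.obj n)} {p' : ∀ n, C(X, S'.obj n)}
      (hS : IsExpansion x S p) {n k l : ℕ} (g : C(S.obj k, S'.obj l))
      (g' : C(S'.obj l, S.obj n)) (hg : g (S.pt k) = S'.pt l) (hg' : g' (S'.pt l) = S.pt n)
      (h : (g.comp (p k)).HomotopicRel (p' l) {x})
      (h' : (g'.comp (p' l)).HomotopicRel (p n) {x}) :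
      ∃ (K : ℕ) (h₁ : k ≤ K) (h₂ : n ≤ K), ∀ a : S.proPi1.obj K,
        FundamentalGroup.mapOfEq g' hg' (FundamentalGroup.mapOfEq g hg (S.proPi1.map h₁ a))
          = S.proPi1.map h₂ a := by
    have q : (g'.comp g) (S.pt k) = S.pt n := (congrArg g' hg).trans hg'
    -- The structure map `S.map le_rfl` stands for the identity as the second factorisation of `p
    -- n`.
    obtain ⟨K, h₁, h₂, hK⟩ := hS.exists_mapOfEq_eq (hS.cw n) (g'.comp g) (S.map le_rfl) q
      (S.map_pt le_rfl) ((h.comp_continuousMap g').trans (h'.trans (hS.comm le_rfl).symm))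
    refine ⟨K, h₁, h₂, fun a => (mapOfEq_mapOfEq g _ hg _ q _).trans ((hK a).trans ?_)⟩
    exact S.proPi1.map_refl n (S.proPi1.map h₂ a)
  choose k g hg using fun n => hS.factor (S'.obj n) (hS'.cw n) (p' n)
  choose l g' hg' using fun n => hS'.factor (S.obj n) (hS.cw n) (p n)
  have hpt (n : ℕ) := pointed hS hS' (g n) (hg n)
  have hpt' (n : ℕ) := pointed hS' hS (g' n) (hg' n)
  exact .of_eventually k (fun n => FundamentalGroup.mapOfEq (g n) (hpt n))
    l (fun n => FundamentalGroup.mapOfEq (g' n) (hpt' n))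
    (comm hS hS' k g hpt hg) (comm hS' hS l g' hpt' hg')
    (fun n => inv hS (g (l n)) (g' n) (hpt (l n)) (hpt' n) (hg (l n)) (hg' n))
    (fun n => inv hS' (g' (k n)) (g n) (hpt' (k n)) (hpt n) (hg' (k n)) (hg n))

theorem homotopicRel_comp_right {X Y Z : Type} [TopologicalSpace X] [TopologicalSpace Y]
    [TopologicalSpace Z] {x : X} {y : Y} {f g : C(Y, Z)} (h : f.HomotopicRel g {y})
    (u : C(X, Y)) (hu : u x = y) : (f.comp u).HomotopicRel (g.comp u) {x} := by
  obtain ⟨F⟩ := h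
  refine ⟨{ F.toHomotopy.compContinuousMap u with prop' := ?_ }⟩
  rintro t _ rfl
  exact F.prop' t (u _) hu

/-- An expansion of a pointed space is an expansion of every homeomorphic pointed space. -/
theorem IsExpansion.comp_homeomorph {Y : Type} [TopologicalSpace Y] {y : Y}
    (hS : IsExpansion x S p) (u : Y ≃ₜ X) (hu : u y = x) :
    IsExpansion y S fun n => (p n).comp (u : C(Y, X)) where
  cw := hS.cw
  pt n := (congrArg (p n) hu).trans (hS.pt n)
  comm h := homotopicRel_comp_right (hS.comm h) _ hu
  factor Z _ hZ f := by
    obtain ⟨n, g, hg⟩ := hS.factor Z hZ (f.comp (u.symm : C(X, Y)))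
    refine ⟨n, g, ?_⟩
    have h := homotopicRel_comp_right hg (u : C(Y, X)) hu
    rwa [ContinuousMap.comp_assoc, ContinuousMap.comp_assoc, Homeomorph.symm_comp_toContinuousMap,
      ContinuousMap.comp_id] at h
  unique Z _ hZ n g g' h := by
    refine hS.unique Z hZ n g g' ?_
    have h' := homotopicRel_comp_right h (u.symm : C(X, Y)) (x := x) (by
      rw [← hu]; exact u.symm_apply_apply y)
    rwa [ContinuousMap.comp_assoc, ContinuousMap.comp_assoc, ContinuousMap.comp_assoc,
      ContinuousMap.comp_assoc, Homeomorph.toContinuousMap_comp_symm,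
      ContinuousMap.comp_id] at h'

end Expansion

/-- Pulling one expansion back along `u` gives two expansions of the same pointed space. -/
theorem IsProPi1.equiv_of_homeomorph {X Y : Type} [TopologicalSpace X] [TopologicalSpace Y]
    {x : X} {y : Y} {P Q : ProGroup} (u : Y ≃ₜ X) (hu : u y = x) (hP : IsProPi1 x P)
    (hQ : IsProPi1 y Q) : P.Equiv Q := by
  obtain ⟨S, p, hS, hPS⟩ := hP
  obtain ⟨S', p', hS', hQS'⟩ := hQ
  exact hPS.trans (((hS.comp_homeomorph u hu).proPi1_equiv hS').trans hQS'.symm)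

/-! ### Maps of Borel constructions -/

section Borel

variable {d : ℕ} {L₁ L₂ : Type} {H : Subgroup (Orth d)} {r : ℝ} {T₁ : Tiling d L₁}
  {T₂ : Tiling d L₂}

/-- The map of Borel spaces induced by a derivation. -/
def DerivesWith.borelMap (h : DerivesWith H r T₁ T₂) (E : Type) [MulAction (Orth d) E] :
    Borel (actingGroup H T₁) (Hull T₁) E → Borel (actingGroup H T₂) (Hull T₂) E :=
  Quotient.map (Prod.map h.hullMap id) (by
    rintro _ ⟨A, e⟩ ⟨g, rfl⟩
    exact ⟨⟨g.1, h.mem_actingGroup g.2⟩, Prod.ext (h.hullMap_smul g A).symm rfl⟩)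

theorem DerivesWith.continuous_borelMap (h : DerivesWith H r T₁ T₂) (hr : 0 < r)
    (hH : SO d ≤ H) (E : Type) [TopologicalSpace E] [MulAction (Orth d) E] :
    Continuous (h.borelMap E) :=
  ((h.continuous_hullMap hr hH).prodMap continuous_id).quotient_map' _

theorem DerivesWith.borelMap_borelMap (h : DerivesWith H r T₁ T₂) {r' : ℝ}
    (h' : DerivesWith H r' T₂ T₁) {E : Type} [MulAction (Orth d) E]
    (z : Borel (actingGroup H T₁) (Hull T₁) E) : h'.borelMap E (h.borelMap E z) = z := by
  induction z using Quotient.inductionOn with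
  | h z =>
    refine congrArg (Quotient.mk _) (Prod.ext ?_ rfl)
    exact h.hullMap_hullMap h' z.1

/-- Mutual derivations induce a homeomorphism of Borel spaces. -/
def DerivesWith.borelHomeomorph (h : DerivesWith H r T₁ T₂) {r' : ℝ}
    (h' : DerivesWith H r' T₂ T₁) (hr : 0 < r) (hr' : 0 < r') (hH : SO d ≤ H) (E : Type)
    [TopologicalSpace E] [MulAction (Orth d) E] :
    Borel (actingGroup H T₁) (Hull T₁) E ≃ₜ Borel (actingGroup H T₂) (Hull T₂) E where
  toFun := h.borelMap E
  invFun := h'.borelMap E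
  left_inv := h.borelMap_borelMap h'
  right_inv := h'.borelMap_borelMap h
  continuous_toFun := h.continuous_borelMap hr hH E
  continuous_invFun := h'.continuous_borelMap hr' hH E

/-- The map of approximants induced by a derivation. -/
def DerivesWith.approxMap (h : DerivesWith H r T₁ T₂) {k n : ℕ} (hk : n + r ≤ k) :
    Approx T₁ k → Approx T₂ n :=
  Quotient.map' h.hullMap fun A B (hAB : rPatch A.1.tiles k 0 = rPatch B.1.tiles k 0) =>
    h.rPatch_hullMap_eq (rPatch_eq_of_le hk hAB)

/-- The map of Borel approximants induced by a derivation. -/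
def DerivesWith.approxBorelMap (h : DerivesWith H r T₁ T₂) (hr : 0 < r) (hH : SO d ≤ H)
    (E : Type) [TopologicalSpace E] [MulAction (Orth d) E] {k n : ℕ} (hk : n + r ≤ k) :
    C(ApproxBorel H T₁ E k, ApproxBorel H T₂ E n) where
  toFun := Quotient.map (Prod.map (h.approxMap hk) id) (by
    rintro _ ⟨A, e⟩ ⟨g, rfl⟩
    refine ⟨⟨g.1, h.mem_actingGroup g.2⟩, Prod.ext ?_ rfl⟩
    induction A using Quotient.inductionOn with
    | h A => exact congrArg (Quotient.mk _) (h.hullMap_smul g A).symm)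
  continuous_toFun :=
    (((h.continuous_hullMap hr hH).quotient_map' _).prodMap continuous_id).quotient_map' _

theorem DerivesWith.approxBorelMap_pt (h : DerivesWith H r T₁ T₂) (hr : 0 < r) (hH : SO d ≤ H)
    {E : Type} [TopologicalSpace E] [MulAction (Orth d) E] (e : E) {k n : ℕ} (hk : n + r ≤ k) :
    h.approxBorelMap hr hH E hk ((borelTower H T₁ e).pt k) = (borelTower H T₂ e).pt n :=
  congrArg
    (fun A => Borel.mk (actingGroup H T₂) (X := Approx T₂ n)
      (Quotient.mk (approxSetoid T₂ n) A) e)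
    h.hullMap_base

theorem DerivesWith.approxBorelMap_forget (h : DerivesWith H r T₁ T₂) (hr : 0 < r)
    (hH : SO d ≤ H) (E : Type) [TopologicalSpace E] [MulAction (Orth d) E] {k l m n : ℕ}
    (hk : n + r ≤ k) (hl : m + r ≤ l) (hmn : m ≤ n) (hlk : l ≤ k) :
    (ApproxBorel.forget H T₂ E hmn).comp (h.approxBorelMap hr hH E hk)
      = (h.approxBorelMap hr hH E hl).comp (ApproxBorel.forget H T₁ E hlk) := by
  ext z
  obtain ⟨⟨A⟩, e⟩ := z
  rfl

/-- On representatives the two hull maps are inverse to each other; only the loss of radius remains,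
so the composite forgets from level `k` to level `n`. -/
theorem DerivesWith.approxBorelMap_comp (h : DerivesWith H r T₁ T₂) {r' : ℝ}
    (h' : DerivesWith H r' T₂ T₁) (hr : 0 < r) (hr' : 0 < r') (hH : SO d ≤ H) (E : Type)
    [TopologicalSpace E] [MulAction (Orth d) E] {k l n : ℕ} (hk : l + r ≤ k) (hl : n + r' ≤ l)
    (hnk : n ≤ k) :
    (h'.approxBorelMap hr' hH E hl).comp (h.approxBorelMap hr hH E hk)
      = ApproxBorel.forget H T₁ E hnk := by
  ext z
  obtain ⟨⟨A⟩, e⟩ := z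
  exact congrArg
    (fun B => Borel.mk (actingGroup H T₁) (X := Approx T₁ n)
      (Quotient.mk (approxSetoid T₁ n) B) e)
    (h.hullMap_hullMap h' A)

/-- The interleaving squares and triangles commute strictly, so constant homotopies suffice and no
later stage than the source index has to be chosen. -/
theorem DerivesWith.proSpaceGroup_equiv (h : DerivesWith H r T₁ T₂) {r' : ℝ}
    (h' : DerivesWith H r' T₂ T₁) (hr : 0 < r) (hr' : 0 < r') (hH : SO d ≤ H) {E : Type}
    [TopologicalSpace E] [MulAction (Orth d) E] (e : E) :
    (proSpaceGroup H T₁ e).Equiv (proSpaceGroup H T₂ e) := by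
  have hidx (r : ℝ) (n : ℕ) : n + r ≤ (n + ⌈r⌉₊ : ℕ) := by
    push_cast
    exact add_le_add_right (Nat.le_ceil r) _
  have comm {L₁ L₂ : Type} {T₁ : Tiling d L₁} {T₂ : Tiling d L₂} {r : ℝ}
      (h : DerivesWith H r T₁ T₂) (hr : 0 < r) {m n : ℕ} (hmn : m ≤ n) :
      ∃ (K : ℕ) (h₁ : n + ⌈r⌉₊ ≤ K) (h₂ : m + ⌈r⌉₊ ≤ K), ∀ a : (proSpaceGroup H T₁ e).obj K,
        (proSpaceGroup H T₂ e).map hmn (FundamentalGroup.mapOfEq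
          (h.approxBorelMap hr hH E (hidx r n)) (h.approxBorelMap_pt hr hH e (hidx r n))
            ((proSpaceGroup H T₁ e).map h₁ a))
          = FundamentalGroup.mapOfEq (h.approxBorelMap hr hH E (hidx r m))
            (h.approxBorelMap_pt hr hH e (hidx r m)) ((proSpaceGroup H T₁ e).map h₂ a) := by
    refine ⟨n + ⌈r⌉₊, le_rfl, Nat.add_le_add_right hmn _, fun a => ?_⟩
    rw [ProGroup.map_refl]
    have q := ((borelTower H T₂ e).map hmn).congr_arg (h.approxBorelMap_pt hr hH e (hidx r n))
    have q' := q.trans ((borelTower H T₂ e).map_pt hmn)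
    refine (mapOfEq_mapOfEq _ ((borelTower H T₂ e).map hmn) _
      ((borelTower H T₂ e).map_pt hmn) q' a).trans ?_
    have hE := h.approxBorelMap_forget hr hH E (hidx r n) (hidx r m) hmn
      (Nat.add_le_add_right hmn _)
    refine Eq.trans ?_ (mapOfEq_mapOfEq ((borelTower H T₁ e).map (Nat.add_le_add_right hmn _)) _
      ((borelTower H T₁ e).map_pt _) (h.approxBorelMap_pt hr hH e (hidx r m)) (by
        exact (DFunLike.congr_fun hE _).symm.trans q') a).symm
    exact mapOfEq_congr (hE ▸ ContinuousMap.HomotopicRel.refl _) _ _ a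
  have inv {L₁ L₂ : Type} {T₁ : Tiling d L₁} {T₂ : Tiling d L₂} {r r' : ℝ}
      (h : DerivesWith H r T₁ T₂) (h' : DerivesWith H r' T₂ T₁) (hr : 0 < r) (hr' : 0 < r')
      (n : ℕ) :
      ∃ (K : ℕ) (h₁ : n + ⌈r'⌉₊ + ⌈r⌉₊ ≤ K) (h₂ : n ≤ K), ∀ a : (proSpaceGroup H T₁ e).obj K,
        FundamentalGroup.mapOfEq (h'.approxBorelMap hr' hH E (hidx r' n))
          (h'.approxBorelMap_pt hr' hH e (hidx r' n)) (FundamentalGroup.mapOfEq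
          (h.approxBorelMap hr hH E (hidx r _)) (h.approxBorelMap_pt hr hH e (hidx r _))
            ((proSpaceGroup H T₁ e).map h₁ a)) = (proSpaceGroup H T₁ e).map h₂ a := by
    have hle : n ≤ n + ⌈r'⌉₊ + ⌈r⌉₊ := by omega
    refine ⟨n + ⌈r'⌉₊ + ⌈r⌉₊, le_rfl, hle, fun a => ?_⟩
    rw [ProGroup.map_refl]
    have hE := h.approxBorelMap_comp h' hr hr' hH E (hidx r _) (hidx r' n) hle
    have q := (DFunLike.congr_fun hE _).trans ((borelTower H T₁ e).map_pt hle)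
    refine (mapOfEq_mapOfEq _ _ _ _ q a).trans ?_
    exact mapOfEq_congr (hE ▸ ContinuousMap.HomotopicRel.refl _) q
      ((borelTower H T₁ e).map_pt hle) a
  exact .of_eventually (fun n => n + ⌈r⌉₊) (fun n => FundamentalGroup.mapOfEq
      (h.approxBorelMap hr hH E (hidx r n)) (h.approxBorelMap_pt hr hH e (hidx r n)))
    (fun n => n + ⌈r'⌉₊) (fun n => FundamentalGroup.mapOfEq
      (h'.approxBorelMap hr' hH E (hidx r' n)) (h'.approxBorelMap_pt hr' hH e (hidx r' n)))
    (comm h hr) (comm h' hr') (inv h h' hr hr') (inv h' h hr' hr)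

/-- Invariance of the pro-fundamental group of the Borel space under S-MLD equivalence. -/
theorem IsSMLDFor.invariance (h : IsSMLDFor H T₁ T₂) (hH : SO d ≤ H) {E : Type}
    [TopologicalSpace E] [MulAction (Orth d) E] (e : E) :
    (proSpaceGroup H T₁ e).Equiv (proSpaceGroup H T₂ e) ∧
    ∀ P₁ P₂ : ProGroup, IsProPi1 (Borel.mk (actingGroup H T₁) (Hull.base T₁) e) P₁ →
      IsProPi1 (Borel.mk (actingGroup H T₂) (Hull.base T₂) e) P₂ → P₁.Equiv P₂ := by
  obtain ⟨⟨r, hr, h₁⟩, r', hr', h₂⟩ := h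
  have h₁ : DerivesWith H r T₁ T₂ := h₁
  have h₂ : DerivesWith H r' T₂ T₁ := h₂
  refine ⟨h₁.proSpaceGroup_equiv h₂ hr hr' hH e, fun P₁ P₂ hP₁ hP₂ => ?_⟩
  -- The homeomorphism runs from the Borel space of `T₂` to that of `T₁`, so the expansion for `T₁`
  -- is the one pulled back.
  exact hP₁.equiv_of_homeomorph (h₂.borelHomeomorph h₁ hr' hr hH E)
    (congrArg (fun A => Borel.mk (actingGroup H T₁) A e) h₂.hullMap_base) hP₂

end Borel

end

end TilingSpace

theorem mainTheorem11 {d : ℕ} (hd : 2 ≤ d) {L₁ L₂ : Type}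
    (T₁ : Tiling d L₁) (T₂ : Tiling d L₂) (hT₁ : HasPointGroup T₁) (hT₂ : HasPointGroup T₂)
    (E : Type) [TopologicalSpace E] [ContractibleSpace E] [MulAction (Orth d) E]
    [ContinuousConstSMul (Orth d) E] (hE : ∀ (g : Orth d) (x : E), g • x = x → g = 1) (e : E) :
    (IsSMLD T₁ T₂ →
      (GammaPlusPro T₁ e).Equiv (GammaPlusPro T₂ e) ∧
      Nonempty (GammaPlus T₁ e ≃* GammaPlus T₂ e) ∧
      ∀ P₁ P₂ : ProGroup,
        IsProPi1 (OmegaG.base T₁ e) P₁ →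
        IsProPi1 (OmegaG.base T₂ e) P₂ →
        P₁.Equiv P₂ ∧ Nonempty (P₁.lim ≃* P₂.lim)) ∧
    (IsSMLDpm T₁ T₂ →
      (GammaPro T₁ e).Equiv (GammaPro T₂ e) ∧
      Nonempty (Gamma T₁ e ≃* Gamma T₂ e) ∧
      ∀ P₁ P₂ : ProGroup,
        IsProPi1 (OmegaGPM.base T₁ e) P₁ →
        IsProPi1 (OmegaGPM.base T₂ e) P₂ →
        P₁.Equiv P₂ ∧ Nonempty (P₁.lim ≃* P₂.lim)) := by
  refine ⟨fun h => ?_, fun h => ?_⟩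
  -- The two cases are `H = SO d` and `H = ⊤`; both contain the rotations used by the tiling
  -- topology.
  · obtain ⟨h₁, h₂⟩ := IsSMLDFor.invariance h le_rfl e
    exact ⟨h₁, h₁.lim_mulEquiv, fun P₁ P₂ hP₁ hP₂ =>
      ⟨h₂ P₁ P₂ hP₁ hP₂, (h₂ P₁ P₂ hP₁ hP₂).lim_mulEquiv⟩⟩
  · obtain ⟨h₁, h₂⟩ := IsSMLDFor.invariance h le_top e
    exact ⟨h₁, h₁.lim_mulEquiv, fun P₁ P₂ hP₁ hP₂ =>
      ⟨h₂ P₁ P₂ hP₁ hP₂, (h₂ P₁ P₂ hP₁ hP₂).lim_mulEquiv⟩⟩
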